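/- Let $H$ be a complex separable infinite-dimensional Hilbert space. "Ideal" means two-sided ideal of $B(H)$. Let $c_o^*$ be the set of nonincreasing real sequences $\xi=\langle\xi_1,\xi_2,\dots\rangle$ with limit $0$, let $\ell_1^*$ be the set of summable sequences in $c_o^*$, and for $\eta\in\ell_1^*$ put $\eta_{a_\infty}:=\big\langle \frac1n\sum_{j=n+1}^\infty\eta_j\big\rangle_{n\ge1}$. For an ideal $I$ let $\Sigma(I)$ be the set of all $\xi\in c_o^*$ that are the sequence $s(X)$ of $s$-numbers of some $X\in I$. The ideal with characteristic set $\Sigma$ is the ideal generated by the diagonal operators $\operatorname{diag}\xi$, $\xi\in\Sigma$ (diagonal in an orthonormal basis of $H$), and $\mathcal L_1$ is the ideal with characteristic set $\ell_1^*$. For an ideal $I\ne\{0\}$ let $\operatorname{se}I$, $\operatorname{sc}I$, ${}_{a_\infty}I$ and $I_{a_\infty}$ be the ideals with characteristic sets $$\Sigma(\operatorname{se}I)=\{\xi\in c_o^*\mid \xi\le\alpha\eta\text{ for some }\alpha\in c_o^*,\ \eta\in\Sigma(I)\},$$ $$\Sigma(\operatorname{sc}I)=\{\xi\in c_o^*\mid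 \alpha\xi\in\Sigma(I)\text{ for all }\alpha\in c_o^*\},$$ $$\Sigma({}_{a_\infty}I)=\{\xi\in\ell_1^*\mid \xi_{a_\infty}\in\Sigma(I)\},$$ $$\Sigma(I_{a_\infty})=\{\xi\in c_o^*\mid \xi=O(\eta_{a_\infty})\text{ for some }\eta\in\Sigma(I\cap\mathcal L_1)\},$$ where inequalities and products of sequences are pointwise, and $\xi=O(\zeta)$ means that there is a constant $M$ with $\xi_n\le M\zeta_n$ for all $n$. **Theorem 6.9.** For every ideal $I\neq\{0\}$: (i) $\operatorname{sc}({}_{a_\infty}I)={}_{a_\infty}(\operatorname{sc}I)$; (ii) $\operatorname{se}(I_{a_\infty})=(\operatorname{se}I)_{a_\infty}$; (iii) $\operatorname{sc}(I_{a_\infty})\supseteq(\operatorname{sc}I)_{a_\infty}$; (iv) $\operatorname{se}({}_{a_\infty}I)={}_{a_\infty}(\operatorname{se}I)$. -/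

import Mathlib

open Filter Topology

namespace OperatorIdeal

noncomputable section

/-! Sequences `⟨ξ₁, ξ₂, …⟩` are indexed from `0`: the term `x n` is `ξ_{n+1}`. -/

/-- `c_o^*`: the nonincreasing real sequences with limit `0` (hence nonnegative). -/
def c0Star : Set (ℕ → ℝ) := {x | Antitone x ∧ Tendsto x atTop (𝓝 0)}

/-- `ℓ_1^*`: the summable sequences in `c_o^*`. -/
def ell1Star : Set (ℕ → ℝ) := {x | x ∈ c0Star ∧ Summable x}

/-- The arithmetic mean at infinity `⟨(1/n) ∑_{j ≥ n+1} η_j⟩` of a summable sequence. -/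
def amInfSeq (y : ℕ → ℝ) : ℕ → ℝ := fun n => (∑' j, y (n + 1 + j)) / ((n : ℝ) + 1)

variable {H : Type*} [NormedAddCommGroup H] [InnerProductSpace ℂ H]

/-- The sequence `s(X)` of `s`-numbers of `X`. Its `n`-th term (counting from `0`) is the distance
from `X` to the bounded operators of rank at most `n`; for compact `X` on a Hilbert space this is
the `n`-th largest eigenvalue of `|X|`, counted with multiplicity. -/
def sNumbers (X : H →L[ℂ] H) : ℕ → ℝ := fun n =>
  ⨅ F : {F : H →L[ℂ] H // LinearMap.rank (F : H →ₗ[ℂ] H) ≤ (n : Cardinal)}, ‖X - F‖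

/-- The characteristic set `Σ(I)` of a two-sided ideal of `B(H)`. -/
def charSet (I : TwoSidedIdeal (H →L[ℂ] H)) : Set (ℕ → ℝ) :=
  {x | x ∈ c0Star ∧ ∃ X ∈ I, sNumbers X = x}

/-- `X` is the diagonal operator `diag x` with respect to some orthonormal basis of `H`. -/
def IsDiag (X : H →L[ℂ] H) (x : ℕ → ℝ) : Prop :=
  ∃ b : HilbertBasis ℕ ℂ H, ∀ n, X (b n) = (x n : ℂ) • b n

/-- The ideal attached to a set `S` of sequences by the Calkin correspondence: the two-sided ideal
of `B(H)` generated by the operators `diag x` with `x ∈ S`. If `S` is a characteristic set, this is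
the ideal with characteristic set `S`. -/
def idealOf (S : Set (ℕ → ℝ)) : TwoSidedIdeal (H →L[ℂ] H) :=
  TwoSidedIdeal.span {X | ∃ x ∈ S, IsDiag X x}

/-- The trace class ideal `𝓛₁`, the ideal with characteristic set `ℓ_1^*`. -/
def traceClass : TwoSidedIdeal (H →L[ℂ] H) := idealOf ell1Star

/-- The soft interior `se I`. -/
def se (I : TwoSidedIdeal (H →L[ℂ] H)) : TwoSidedIdeal (H →L[ℂ] H) :=
  idealOf {x | x ∈ c0Star ∧ ∃ a ∈ c0Star, ∃ y ∈ charSet I, ∀ n, x n ≤ a n * y n}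

/-- The soft cover `sc I`. -/
def sc (I : TwoSidedIdeal (H →L[ℂ] H)) : TwoSidedIdeal (H →L[ℂ] H) :=
  idealOf {x | x ∈ c0Star ∧ ∀ a ∈ c0Star, (fun n => a n * x n) ∈ charSet I}

/-- The pre-arithmetic mean at infinity `_{a_∞} I`. -/
def preAmInf (I : TwoSidedIdeal (H →L[ℂ] H)) : TwoSidedIdeal (H →L[ℂ] H) :=
  idealOf {x | x ∈ ell1Star ∧ amInfSeq x ∈ charSet I}

/-- The arithmetic mean at infinity `I_{a_∞}`; here `ξ = O(η)` for sequences means that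
`ξ_n ≤ M η_n` for all `n`, with a constant `M`. -/
def amInf (I : TwoSidedIdeal (H →L[ℂ] H)) : TwoSidedIdeal (H →L[ℂ] H) :=
  idealOf {x | x ∈ c0Star ∧
    ∃ y ∈ charSet (I ⊓ traceClass), ∃ M : ℝ, ∀ n, x n ≤ M * amInfSeq y n}

end

end OperatorIdeal

/-! Every ideal involved is generated by diagonal operators, so the theorem becomes four relations
between sets of sequences. This rests on two facts. The characteristic set of a nonzero ideal has
the closure properties `IsCharSet`, because `diag s(X)` lies in every ideal containing `X`
(`DiagOn.mem_of_sNumbers`). Conversely, a set with these properties is the characteristic set of the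
ideal it generates (`charSet_idealOf`).

For sequences, the question is how a null factor passes through the mean at infinity. Pulling it out
is free (`amInfSeq_mul_le`). Pushing it in costs a factor 2 and a slower null sequence
(`exists_mul_amInfSeq_le`). With the fact that `x` is summable once all its null multiples are, this
gives (i), (iii) and one inclusion of (ii).

The other inclusion of (ii) and the hard half of (iv) require writing a summable `x` as at most `b *
y`, with `b` null and `y` summable. For (iv), the mean of `y` may exceed that of `x` only by a
factor of order `1 / a`, for a prescribed null `a` (`exists_le_mul_amInfSeq`). -/

namespace OperatorIdeal

/-! ### Sequences -/

/-- The closure properties of the characteristic set of a nonzero ideal. -/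
structure IsCharSet (S : Set (ℕ → ℝ)) : Prop where
  subset : S ⊆ c0Star
  solid : ∀ {x y}, x ∈ c0Star → y ∈ S → (∀ n, x n ≤ y n) → x ∈ S
  add : ∀ {x y}, x ∈ S → y ∈ S → (fun n => x n + y n) ∈ S
  double : ∀ {x}, x ∈ S → (fun n => x (n / 2)) ∈ S
  finite : ∀ {x} (N : ℕ), x ∈ c0Star → (∀ n, N ≤ n → x n = 0) → x ∈ S

namespace c0Star

theorem nonneg {x : ℕ → ℝ} (hx : x ∈ c0Star) (n : ℕ) : 0 ≤ x n :=
  hx.1.le_of_tendsto hx.2 n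

theorem zero : (fun _ => 0 : ℕ → ℝ) ∈ c0Star := ⟨antitone_const, tendsto_const_nhds⟩

theorem add {x y : ℕ → ℝ} (hx : x ∈ c0Star) (hy : y ∈ c0Star) :
    (fun n => x n + y n) ∈ c0Star :=
  ⟨hx.1.add hy.1, by simpa using hx.2.add hy.2⟩

theorem mul {x y : ℕ → ℝ} (hx : x ∈ c0Star) (hy : y ∈ c0Star) :
    (fun n => x n * y n) ∈ c0Star :=
  ⟨fun _ _ h => mul_le_mul (hx.1 h) (hy.1 h) (nonneg hy _) (nonneg hx _),
    by simpa using hx.2.mul hy.2⟩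

theorem smul {x : ℕ → ℝ} (hx : x ∈ c0Star) {c : ℝ} (hc : 0 ≤ c) :
    (fun n => c * x n) ∈ c0Star :=
  ⟨fun _ _ h => mul_le_mul_of_nonneg_left (hx.1 h) hc, by simpa using hx.2.const_mul c⟩

theorem min {x y : ℕ → ℝ} (hx : x ∈ c0Star) (hy : y ∈ c0Star) :
    (fun n => min (x n) (y n)) ∈ c0Star :=
  ⟨hx.1.min hy.1, by simpa using hx.2.min hy.2⟩

theorem max {x y : ℕ → ℝ} (hx : x ∈ c0Star) (hy : y ∈ c0Star) :
    (fun n => max (x n) (y n)) ∈ c0Star :=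
  ⟨hx.1.max hy.1, by simpa using hx.2.max hy.2⟩

/-- Reindexing along a monotone map tending to infinity preserves `c0Star`. -/
theorem comp {x : ℕ → ℝ} (hx : x ∈ c0Star) {f : ℕ → ℕ} (hf : Monotone f)
    (h : Tendsto f atTop atTop) : (fun n => x (f n)) ∈ c0Star :=
  ⟨hx.1.comp_monotone hf, hx.2.comp h⟩

theorem tendsto_half : Tendsto (fun n : ℕ => n / 2) atTop atTop :=
  tendsto_atTop.2 fun b => (eventually_ge_atTop (2 * b)).mono fun n hn => by omega

theorem double {x : ℕ → ℝ} (hx : x ∈ c0Star) : (fun n => x (n / 2)) ∈ c0Star :=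
  comp hx (fun _ _ h => Nat.div_le_div_right h) tendsto_half

theorem inv_succ : (fun n : ℕ => 1 / ((n : ℝ) + 1)) ∈ c0Star :=
  ⟨fun m n h => by
    have : (m : ℝ) ≤ n := by exact_mod_cast h
    dsimp only; gcongr, tendsto_one_div_add_atTop_nhds_zero_nat⟩

end c0Star

namespace IsCharSet

variable {S : Set (ℕ → ℝ)}

theorem two_pow_smul (hS : IsCharSet S) {x : ℕ → ℝ} (hx : x ∈ S) (k : ℕ) :
    (fun n => (2 : ℝ) ^ k * x n) ∈ S := by
  induction k with
  | zero => simpa using hx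
  | succ k ih =>
    convert hS.add ih ih using 2
    ring

/-- Scaling is not among the closure axioms; repeated self-addition exceeds any constant. -/
theorem of_le_smul (hS : IsCharSet S) {x y : ℕ → ℝ} (hx : x ∈ c0Star) (hy : y ∈ S) (M : ℝ)
    (h : ∀ n, x n ≤ M * y n) : x ∈ S := by
  obtain ⟨k, hk⟩ := pow_unbounded_of_one_lt M (one_lt_two)
  exact hS.solid hx (hS.two_pow_smul hy k) fun n => (h n).trans
    (mul_le_mul_of_nonneg_right hk.le (c0Star.nonneg (hS.subset hy) n))

end IsCharSet

/-! ### Tails and the arithmetic mean at infinity -/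

/-- The tail sum `∑_{j ≥ n} x_j`. -/
noncomputable def tailSum (x : ℕ → ℝ) (n : ℕ) : ℝ := ∑' j, x (n + j)

theorem amInfSeq_eq (x : ℕ → ℝ) (n : ℕ) :
    amInfSeq x n = tailSum x (n + 1) / ((n : ℝ) + 1) := rfl

theorem summable_shift {x : ℕ → ℝ} (hx : Summable x) (n : ℕ) : Summable fun j => x (n + j) := by
  simpa only [add_comm] using (summable_nat_add_iff n).2 hx

theorem tailSum_succ {x : ℕ → ℝ} (hx : Summable x) (n : ℕ) :
    tailSum x n = x n + tailSum x (n + 1) := by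
  rw [tailSum, (summable_shift hx n).tsum_eq_zero_add, tailSum]
  simp only [add_zero]
  congr 2 with j
  ring_nf

theorem tailSum_nonneg {x : ℕ → ℝ} (hx : ∀ n, 0 ≤ x n) (n : ℕ) : 0 ≤ tailSum x n :=
  tsum_nonneg fun _ => hx _

theorem tailSum_antitone {x : ℕ → ℝ} (hx : Summable x) (h0 : ∀ n, 0 ≤ x n) :
    Antitone (tailSum x) :=
  antitone_nat_of_succ_le fun n => by linarith [tailSum_succ hx n, h0 n]

theorem tailSum_tendsto (x : ℕ → ℝ) : Tendsto (tailSum x) atTop (𝓝 0) := by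
  convert tendsto_sum_nat_add x using 2 with n
  simp only [tailSum, add_comm]

theorem tailSum_c0Star {x : ℕ → ℝ} (hx : x ∈ ell1Star) : tailSum x ∈ c0Star :=
  ⟨tailSum_antitone hx.2 (c0Star.nonneg hx.1), tailSum_tendsto x⟩

theorem tailSum_mono {x y : ℕ → ℝ} (hx : Summable x) (hy : Summable y) (n : ℕ)
    (h : ∀ k, n ≤ k → x k ≤ y k) : tailSum x n ≤ tailSum y n :=
  (summable_shift hx n).tsum_le_tsum (fun _ => h _ (by omega)) (summable_shift hy n)

theorem tailSum_add {x y : ℕ → ℝ} (hx : Summable x) (hy : Summable y) (n : ℕ) :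
    tailSum (fun k => x k + y k) n = tailSum x n + tailSum y n :=
  (summable_shift hx n).tsum_add (summable_shift hy n)

theorem tailSum_const_mul (c : ℝ) (x : ℕ → ℝ) (n : ℕ) :
    tailSum (fun k => c * x k) n = c * tailSum x n := tsum_mul_left

theorem summable_double {x : ℕ → ℝ} (hx : Summable x) : Summable fun n => x (n / 2) := by
  refine Summable.even_add_odd (f := fun n => x (n / 2)) ?_ ?_
  · simpa using hx
  · convert hx using 3
    omega

theorem tailSum_double {x : ℕ → ℝ} (hx : Summable x) (m : ℕ) :
    tailSum (fun n => x (n / 2)) (2 * m) = 2 * tailSum x m := by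
  have e1 : ∀ k, (2 * m + 2 * k) / 2 = m + k := fun k => by omega
  have e2 : ∀ k, (2 * m + (2 * k + 1)) / 2 = m + k := fun k => by omega
  have hs := summable_shift hx m
  rw [tailSum, ← tsum_even_add_odd (f := fun j => x ((2 * m + j) / 2))]
  · simp only [e1, e2, tailSum]
    ring
  · simpa only [e1] using hs
  · simpa only [e2] using hs

namespace ell1Star

theorem of_le {x y : ℕ → ℝ} (hx : x ∈ c0Star) (hy : Summable y) (h : ∀ n, x n ≤ y n) :
    x ∈ ell1Star :=
  ⟨hx, hy.of_nonneg_of_le (c0Star.nonneg hx) h⟩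

theorem add {x y : ℕ → ℝ} (hx : x ∈ ell1Star) (hy : y ∈ ell1Star) :
    (fun n => x n + y n) ∈ ell1Star := ⟨c0Star.add hx.1 hy.1, hx.2.add hy.2⟩

theorem double {x : ℕ → ℝ} (hx : x ∈ ell1Star) : (fun n => x (n / 2)) ∈ ell1Star :=
  ⟨c0Star.double hx.1, summable_double hx.2⟩

theorem mul_left {a x : ℕ → ℝ} (ha : a ∈ c0Star) (hx : x ∈ ell1Star) :
    (fun n => a n * x n) ∈ ell1Star :=
  of_le (c0Star.mul ha hx.1) (hx.2.mul_left (a 0)) fun n =>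
    mul_le_mul_of_nonneg_right (ha.1 (Nat.zero_le n)) (c0Star.nonneg hx.1 n)

theorem isCharSet : IsCharSet ell1Star where
  subset _ h := h.1
  solid hx hy h := of_le hx hy.2 h
  add := add
  double := double
  finite N hx h := ⟨hx, summable_of_ne_finset_zero (s := Finset.range N) fun n hn =>
    h n (by simpa using hn)⟩

end ell1Star

theorem amInfSeq_mem_c0Star {x : ℕ → ℝ} (hx : x ∈ ell1Star) : amInfSeq x ∈ c0Star := by
  have h := c0Star.mul (c0Star.comp (tailSum_c0Star hx) (f := fun n => n + 1)
    (fun _ _ h => Nat.succ_le_succ h) (tendsto_add_atTop_nat 1)) c0Star.inv_succ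
  convert h using 1
  ext n
  rw [amInfSeq_eq, mul_one_div]

theorem amInfSeq_add {x y : ℕ → ℝ} (hx : Summable x) (hy : Summable y) (n : ℕ) :
    amInfSeq (fun k => x k + y k) n = amInfSeq x n + amInfSeq y n := by
  simp only [amInfSeq_eq, tailSum_add hx hy, add_div]

theorem amInfSeq_mono {x y : ℕ → ℝ} (hx : Summable x) (hy : Summable y)
    (h : ∀ k, x k ≤ y k) (n : ℕ) : amInfSeq x n ≤ amInfSeq y n := by
  simp only [amInfSeq_eq]
  exact div_le_div_of_nonneg_right (tailSum_mono hx hy _ fun k _ => h k) (by positivity)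

/-- The mean at `n` only sees indices beyond `n`, where `a` is at most `a n`. -/
theorem amInfSeq_mul_le {a x : ℕ → ℝ} (ha : a ∈ c0Star) (hx : x ∈ ell1Star) (n : ℕ) :
    amInfSeq (fun k => a k * x k) n ≤ a n * amInfSeq x n := by
  simp only [amInfSeq_eq, mul_div_assoc']
  rw [← tailSum_const_mul]
  refine div_le_div_of_nonneg_right (tailSum_mono (ell1Star.mul_left ha hx).2 (hx.2.mul_left _) _
    fun k hk => ?_) (by positivity)
  exact mul_le_mul_of_nonneg_right (ha.1 (by omega)) (c0Star.nonneg hx.1 k)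

theorem amInfSeq_half_le {x : ℕ → ℝ} (hx : x ∈ ell1Star) (n : ℕ) :
    amInfSeq x (n / 2) ≤ amInfSeq (fun k => x (k / 2)) n := by
  have h := (tailSum_c0Star (ell1Star.double hx)).1 (show n + 1 ≤ 2 * (n / 2 + 1) by omega)
  rw [tailSum_double hx.2] at h
  rw [amInfSeq_eq, amInfSeq_eq, div_le_div_iff₀ (by positivity) (by positivity)]
  have h0 := tailSum_nonneg (c0Star.nonneg hx.1) (n / 2 + 1)
  have h1 : (n : ℝ) + 1 ≤ 2 * ((n / 2 : ℕ) + 1) := by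
    exact_mod_cast (by omega : n + 1 ≤ 2 * (n / 2 + 1))
  nlinarith

/-- Rounding `n + 1` down to an even number enlarges the tail. The index `n / 2` would be too large;
`n / 2 / 2` is safe and corresponds to doubling twice. -/
theorem amInfSeq_double_le {x : ℕ → ℝ} (hx : x ∈ ell1Star) {n : ℕ} (hn : 1 ≤ n) :
    amInfSeq (fun k => x (k / 2)) n ≤ amInfSeq x (n / 2 / 2) := by
  obtain ⟨m, hm⟩ : ∃ m, (n + 1) / 2 = m + 1 := ⟨(n + 1) / 2 - 1, by omega⟩
  have h := (tailSum_c0Star (ell1Star.double hx)).1 (show 2 * (m + 1) ≤ n + 1 by omega)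
  rw [tailSum_double hx.2] at h
  refine le_trans ?_ ((amInfSeq_mem_c0Star hx).1 (show n / 2 / 2 ≤ m by omega))
  rw [amInfSeq_eq, amInfSeq_eq, div_le_div_iff₀ (by positivity) (by positivity)]
  have h0 := tailSum_nonneg (c0Star.nonneg hx.1) (m + 1)
  have h1 : 2 * ((m : ℝ) + 1) ≤ n + 1 := by exact_mod_cast (by omega : 2 * (m + 1) ≤ n + 1)
  nlinarith

/-! ### Softness of summable sequences -/

/-- If the partial sums `S n` diverge, the weight `(1 + S n)^(-1/2)` is null, yet the weighted sums
are at least `S n / √(1 + S n)`, which is unbounded. -/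
theorem summable_of_forall_mul_summable {x : ℕ → ℝ} (hx : x ∈ c0Star)
    (h : ∀ a ∈ c0Star, Summable fun n => a n * x n) : Summable x := by
  by_contra hn
  have h0 := c0Star.nonneg hx
  set S : ℕ → ℝ := fun n => ∑ i ∈ Finset.range n, x i with hS
  have hT : Tendsto S atTop atTop := (not_summable_iff_tendsto_nat_atTop_of_nonneg h0).1 hn
  have hS0 : ∀ n, 0 ≤ S n := fun n => Finset.sum_nonneg fun i _ => h0 i
  have hSm : Monotone S := fun m n hmn =>
    Finset.sum_le_sum_of_subset_of_nonneg (Finset.range_mono hmn) fun i _ _ => h0 i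
  set a : ℕ → ℝ := fun n => (√(1 + S n))⁻¹ with ha
  have hpos : ∀ n, 0 < √(1 + S n) := fun n => Real.sqrt_pos.2 (by linarith [hS0 n])
  have ha0 : a ∈ c0Star := by
    refine ⟨fun m n hmn => ?_, ?_⟩
    · exact inv_anti₀ (hpos m) (Real.sqrt_le_sqrt (by linarith [hSm hmn]))
    · exact tendsto_inv_atTop_zero.comp
        (Real.tendsto_sqrt_atTop.comp (tendsto_atTop_add_const_left _ _ hT))
  have hs := h a ha0
  set L := ∑' n, a n * x n
  have hL : ∀ n, a n * S n ≤ L := fun n => by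
    refine le_trans ?_ (hs.sum_le_tsum (Finset.range n)
      fun i _ => mul_nonneg (c0Star.nonneg ha0 i) (h0 i))
    rw [hS, Finset.mul_sum]
    exact Finset.sum_le_sum fun i hi => mul_le_mul_of_nonneg_right
      (ha0.1 (Finset.mem_range.1 hi).le) (h0 i)
  obtain ⟨n, hn⟩ := (hT.eventually_ge_atTop (L ^ 2 + 1)).exists
  have h1 : S n ≤ L * √(1 + S n) := by
    have := hL n
    rwa [ha, inv_mul_eq_div, div_le_iff₀ (hpos n)] at this
  have h2 : S n ^ 2 ≤ L ^ 2 * (1 + S n) := by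
    rw [← Real.sq_sqrt (by linarith [hS0 n] : 0 ≤ 1 + S n), ← mul_pow]
    exact pow_le_pow_left₀ (hS0 n) h1 2
  nlinarith [sq_nonneg L]

/-- For each `m` with `n < m n` there is a monotone unbounded `g` such that `g j` is the first
index with `j < m (g j)`. -/
theorem exists_firstExceeding (m : ℕ → ℕ) (hm : ∀ n, n < m n) :
    ∃ g : ℕ → ℕ, Monotone g ∧ Tendsto g atTop atTop ∧ (∀ j, j < m (g j)) ∧
      ∀ j n, j < m n → g j ≤ n := by
  have hex : ∀ j, ∃ n, j < m n := fun j => ⟨j, hm j⟩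
  have hle : ∀ j n, j < m n → Nat.find (hex j) ≤ n := fun j n h => Nat.find_min' _ h
  refine ⟨fun j => Nat.find (hex j), fun i j hij => ?_, tendsto_atTop.2 fun B => ?_,
    fun j => Nat.find_spec (hex j), hle⟩
  · exact hle i _ (hij.trans_lt (Nat.find_spec (hex j)))
  -- Beyond this sum, `j` exceeds every `m n` with `n < B`, so the first exceeding index is at least
  -- `B`.
  · filter_upwards [eventually_ge_atTop (∑ n ∈ Finset.range B, m n)] with j hj
    by_contra! hlt
    have h1 := Nat.find_spec (hex j)
    have h2 : m (Nat.find (hex j)) ≤ ∑ n ∈ Finset.range B, m n :=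
      Finset.single_le_sum (f := m) (fun _ _ => Nat.zero_le _) (Finset.mem_range.2 hlt)
    omega

/-- Both differences are sums over the block `n ≤ j < N`, where `b` is at least `c`. -/
theorem mul_tailSum_sub_le {b x : ℕ → ℝ} (hx : ∀ n, 0 ≤ x n) (hs : Summable x)
    (hbs : Summable fun n => b n * x n) {c : ℝ} {n N : ℕ} (hnN : n ≤ N)
    (h : ∀ j < N, c ≤ b j) :
    c * (tailSum x n - tailSum x N) ≤
      tailSum (fun j => b j * x j) n - tailSum (fun j => b j * x j) N := by
  induction N, hnN using Nat.le_induction with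
  | base => simp
  | succ N _ ih =>
    have h1 := ih fun j hj => h j (by omega)
    rw [tailSum_succ hs N, tailSum_succ hbs N] at h1
    nlinarith [mul_le_mul_of_nonneg_right (h N (by omega)) (hx N)]

/-- A null factor can be moved inside the arithmetic mean at infinity. -/
theorem exists_mul_amInfSeq_le {a x : ℕ → ℝ} (ha : a ∈ c0Star) (hx : x ∈ ell1Star) :
    ∃ b ∈ c0Star, ∀ n, a n * amInfSeq x n ≤ 2 * amInfSeq (fun k => b k * x k) n := by
  have hT0 := tailSum_nonneg (c0Star.nonneg hx.1)
  -- The block from `n + 1` up to `m` carries at least half of the tail. With `b = a ∘ g`, all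
  -- weights on that block are at least `a n`, whence the factor 2.
  have hm : ∀ n, ∃ m, n < m ∧ tailSum x m ≤ tailSum x (n + 1) / 2 := fun n => by
    rcases (hT0 (n + 1)).eq_or_lt with h | h
    · exact ⟨n + 1, by omega, by rw [← h]; simp⟩
    · obtain ⟨m, h1, h2⟩ := (((tailSum_tendsto x).eventually_lt_const (half_pos h)).and
        (eventually_gt_atTop n)).exists
      exact ⟨m, h2, h1.le⟩
  choose m hnm hm using hm
  obtain ⟨g, hgm, hgt, -, hg⟩ := exists_firstExceeding m hnm
  have hb := c0Star.comp ha hgm hgt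
  refine ⟨_, hb, fun n => ?_⟩
  have h1 := mul_tailSum_sub_le (c0Star.nonneg hx.1) hx.2 (ell1Star.mul_left hb hx).2
    (c := a n) (hnm n) fun j hj => ha.1 (hg j n hj)
  have h2 := tailSum_nonneg (c0Star.nonneg (ell1Star.mul_left hb hx).1) (m n)
  have h3 := hm n
  have h4 := c0Star.nonneg ha n
  simp only [amInfSeq_eq, mul_div_assoc']
  refine div_le_div_of_nonneg_right ?_ (by positivity)
  nlinarith [mul_le_mul_of_nonneg_left h3 h4]

theorem summable_max {x : ℕ → ℝ} (hx : x ∈ ell1Star) (N : ℕ) : Summable fun j => x (max j N) :=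
  hx.2.of_nonneg_of_le (fun _ => c0Star.nonneg hx.1 _) fun _ => hx.1.1 (le_max_left _ _)

/-- The truncation is flat up to `N` and follows `x` afterwards; `x` itself dominates both pieces.
-/
theorem tsum_max_tendsto {x : ℕ → ℝ} (hx : x ∈ ell1Star) :
    Tendsto (fun N => ∑' j, x (max j N)) atTop (𝓝 0) := by
  have : Tendsto (fun N => ∑' j, x (max j N)) atTop (𝓝 (∑' _ : ℕ, (0 : ℝ))) := by
    refine tendsto_tsum_of_dominated_convergence hx.2 (fun j => ?_) (Eventually.of_forall
      fun N j => ?_)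
    · exact hx.1.2.comp (tendsto_atTop_mono (fun N => le_max_right j N) tendsto_id)
    · rw [Real.norm_of_nonneg (c0Star.nonneg hx.1 _)]
      exact hx.1.1 (le_max_left _ _)
  simpa using this

/-- Superposition of the truncations `n ↦ x (max n (u k))` of a summable sequence. -/
theorem tsum_truncations {x : ℕ → ℝ} (hx : x ∈ ell1Star) {u : ℕ → ℕ}
    (hM : Summable fun k => ∑' j, x (max j (u k))) :
    (fun n => ∑' k, x (max n (u k))) ∈ ell1Star ∧ (∀ n, Summable fun k => x (max n (u k))) ∧
      ∀ n, (Summable fun k => tailSum (fun j => x (max j (u k))) n) ∧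
        tailSum (fun n => ∑' k, x (max n (u k))) n =
          ∑' k, tailSum (fun j => x (max j (u k))) n := by
  have hx0 := c0Star.nonneg hx.1
  -- For nonnegative terms iterated summability gives joint summability, which justifies exchanging
  -- the sums.
  have hz2 : Summable fun p : ℕ × ℕ => x (max p.2 (u p.1)) :=
    (summable_prod_of_nonneg fun _ => hx0 _).2 ⟨fun k => summable_max hx (u k), hM⟩
  have hzk : ∀ n, Summable fun k => x (max n (u k)) := fun n => hz2.prod_symm.prod_factor n
  have hws : Summable fun n => ∑' k, x (max n (u k)) := hz2.prod_symm.prod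
  have hwa : Antitone fun n => ∑' k, x (max n (u k)) := fun m n hmn =>
    (hzk n).tsum_le_tsum (fun k => hx.1.1 (max_le_max_right _ hmn)) (hzk m)
  refine ⟨⟨⟨hwa, hws.tendsto_atTop_zero⟩, hws⟩, hzk, fun n => ?_⟩
  have hz3 : Summable fun p : ℕ × ℕ => x (max (n + p.2) (u p.1)) := by
    have hi : Function.Injective fun p : ℕ × ℕ => (p.1, n + p.2) := fun p q h => by
      simp only [Prod.mk.injEq, add_right_inj] at h
      exact Prod.ext h.1 h.2
    simpa only [Function.comp_def] using hz2.comp_injective hi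
  have h1 : Summable fun k => ∑' j, x (max (n + j) (u k)) := hz3.prod
  have h2 : ∑' j, ∑' k, x (max (n + j) (u k)) = ∑' k, ∑' j, x (max (n + j) (u k)) :=
    Summable.tsum_comm (f := fun k j => x (max (n + j) (u k))) hz3
  simp only [tailSum]
  exact ⟨h1, h2⟩

/-- A summable monotone sequence factors through a null sequence, with arbitrarily slow loss in the
arithmetic mean at infinity. -/
theorem exists_le_mul_amInfSeq {a x : ℕ → ℝ} (ha : a ∈ c0Star) (hx : x ∈ ell1Star) :
    ∃ b ∈ c0Star, ∃ y ∈ ell1Star, (∀ n, x n ≤ b n * y n) ∧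
      ∃ C, ∀ n, a n * amInfSeq y n ≤ C * amInfSeq x n := by
  have hx0 := c0Star.nonneg hx.1
  have hT0 := tailSum_nonneg hx0
  have hTa := tailSum_antitone hx.2 hx0
  have hzs := summable_max hx
  set M : ℕ → ℝ := fun N => ∑' j, x (max j N) with hM
  have hMt : Tendsto M atTop (𝓝 0) := tsum_max_tendsto hx
  have hTM : ∀ N, tailSum x N ≤ M N := fun N =>
    (summable_shift hx.2 N).tsum_le_tsum (fun j => hx.1.1 (by omega)) (hzs N)
  -- The levels `u k` are chosen so sparse that the masses `M (u k)` decay geometrically and `a` is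
  -- at most `1 / (k + 1)` from `u k` on.
  have hstep : ∀ k n : ℕ, ∃ N, n < N ∧ M N ≤ tailSum x n / 2 ∧ a N ≤ 1 / ((k : ℝ) + 1) := by
    intro k n
    have h1 := ha.2.eventually_lt_const (by positivity : (0 : ℝ) < 1 / ((k : ℝ) + 1))
    have h2 : ∀ᶠ N in atTop, M N ≤ tailSum x n / 2 := by
      rcases (hT0 n).eq_or_lt with h | h
      · filter_upwards [eventually_ge_atTop n] with N hN
        have h3 : ∀ j, x (max j N) = 0 := fun j => by
          have h4 := (summable_shift hx.2 n).le_tsum (max j N - n) fun _ _ => hx0 _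
          rw [show n + (max j N - n) = max j N by omega] at h4
          exact le_antisymm (h4.trans h.ge) (hx0 _)
        simp [hM, h3, ← h]
      · exact (hMt.eventually_lt_const (half_pos h)).mono fun _ h => h.le
    obtain ⟨N, h3, h4, h5⟩ := (h1.and (h2.and (eventually_gt_atTop n))).exists
    exact ⟨N, h5, h4, h3.le⟩
  choose f hf1 hf2 hf3 using hstep
  set u : ℕ → ℕ := fun k => Nat.rec (f 0 0) (fun k v => f (k + 1) v) k with hu
  have hus : ∀ k, u (k + 1) = f (k + 1) (u k) := fun k => rfl
  have hum : StrictMono u := strictMono_nat_of_lt_succ fun k => by rw [hus]; exact hf1 _ _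
  have hua : ∀ k, a (u k) ≤ 1 / ((k : ℝ) + 1) := fun k => by
    cases k with
    | zero => exact hf3 0 0
    | succ k => rw [hus]; exact hf3 _ _
  have huT : ∀ k, M (u (k + 1)) ≤ tailSum x (u k) / 2 := fun k => by rw [hus]; exact hf2 _ _
  have hun : ∀ k, k < u k := fun k => by
    induction k with
    | zero => exact hf1 0 0
    | succ k ih => exact lt_of_le_of_lt ih (hum (Nat.lt_succ_self k))
  obtain ⟨g, hgm, hgt, hg1, hg2⟩ := exists_firstExceeding u hun
  have hgeo : ∀ K i, M (u (K + 1 + i)) ≤ tailSum x (u K) / 2 * (1 / 2) ^ i := fun K i => by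
    induction i with
    | zero => simpa using huT K
    | succ i ih =>
      have h1 := huT (K + 1 + i)
      have h2 := hTM (u (K + 1 + i))
      rw [← add_assoc, pow_succ]
      linarith
  have hMs : Summable fun k => M (u k) := by
    refine (summable_nat_add_iff 1).1 (Summable.of_nonneg_of_le (fun i => tsum_nonneg fun _ => hx0 _)
      (fun i => ?_) (summable_geometric_two.mul_left (tailSum x (u 0) / 2)))
    simpa only [zero_add, add_comm 1 i] using hgeo 0 i
  obtain ⟨hwl, hzk, hwz⟩ := tsum_truncations hx hMs
  set w : ℕ → ℝ := fun n => ∑' k, x (max n (u k))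
  refine ⟨fun n => 1 / ((g n : ℝ) + 1), c0Star.comp c0Star.inv_succ hgm hgt,
    fun n => x n + w n, ell1Star.add hx hwl, fun n => ?_, 1 + 3 * a 0, fun n => ?_⟩
  -- For each of the `g n` indices `k` with `u k ≤ n`, the truncation at level `u k` equals `x n` at
  -- `n`.
  · have h1 : (g n : ℝ) * x n ≤ w n := by
      refine le_trans ?_ ((hzk n).sum_le_tsum (Finset.range (g n)) fun _ _ => hx0 _)
      rw [Finset.sum_congr rfl (g := fun _ => x n)]
      · simp
      · intro k hk
        rw [max_eq_left]
        by_contra! h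
        have := hg2 n k h
        have := Finset.mem_range.1 hk
        omega
    dsimp only
    rw [one_div, inv_mul_eq_div, le_div_iff₀ (by positivity)]
    linarith
  · set K := g n
    set t := tailSum x (n + 1) with ht
    have ht0 : 0 ≤ t := hT0 _
    have hzt : ∀ k, tailSum (fun j => x (max j (u k))) (n + 1) ≤ t := fun k =>
      tailSum_mono (hzs _) hx.2 _ fun j _ => hx.1.1 (le_max_left _ _)
    have hzM : ∀ k, tailSum (fun j => x (max j (u k))) (n + 1) ≤ M (u k) := fun k =>
      (tailSum_antitone (hzs _) (fun _ => hx0 _) (Nat.zero_le _)).trans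
        (by simp [tailSum, hM])
    obtain ⟨hts, hwt⟩ := hwz (n + 1)
    -- The first `K + 1` truncations contribute at most `t` each. The rest form a geometric series
    -- of total `tailSum x (u K)`, at most `t` since `n < u K`.
    have hwK : tailSum w (n + 1) ≤ (K + 2) * t := by
      rw [hwt, ← hts.sum_add_tsum_nat_add (K + 1)]
      have h1 : ∑ k ∈ Finset.range (K + 1), tailSum (fun j => x (max j (u k))) (n + 1) ≤
          (K + 1) * t := by
        refine (Finset.sum_le_sum fun k _ => hzt k).trans ?_
        simp
      have h2 : ∑' i, tailSum (fun j => x (max j (u (i + (K + 1))))) (n + 1) ≤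
          tailSum x (u K) / 2 * 2 := by
        rw [show tailSum x (u K) / 2 * 2 = ∑' i : ℕ, tailSum x (u K) / 2 * (1 / 2) ^ i by
          rw [tsum_mul_left, tsum_geometric_two]]
        refine ((summable_nat_add_iff (K + 1)).2 hts).tsum_le_tsum (fun i => ?_)
          (summable_geometric_two.mul_left _)
        rw [add_comm i]
        exact (hzM _).trans (hgeo K i)
      have h3 : tailSum x (u K) ≤ t := hTa (hg1 n)
      linarith
    have haK : a n * K ≤ 1 := by
      rcases Nat.eq_zero_or_pos K with h | h
      · simp [h]
      · obtain ⟨k, hk⟩ : ∃ k, K = k + 1 := ⟨K - 1, by omega⟩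
        have h1 : u k ≤ n := by
          by_contra! h2
          have := hg2 n k h2
          omega
        have h3 := (ha.1 h1).trans (hua k)
        rw [le_div_iff₀ (by positivity)] at h3
        rw [hk]
        exact_mod_cast h3
    have ha3 : a n ≤ a 0 := ha.1 (Nat.zero_le n)
    simp only [amInfSeq_eq, mul_div_assoc']
    refine div_le_div_of_nonneg_right ?_ (by positivity)
    rw [tailSum_add hx.2 hwl.2]
    calc a n * (t + tailSum w (n + 1)) ≤ a n * (t + (K + 2) * t) :=
          mul_le_mul_of_nonneg_left (by linarith) (c0Star.nonneg ha n)
      _ = (a n * K + 3 * a n) * t := by ring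
      _ ≤ (1 + 3 * a 0) * t := mul_le_mul_of_nonneg_right (by linarith) ht0

/-! ### Operations on characteristic sets -/

/-- The characteristic set of the soft interior. -/
def softInterior (S : Set (ℕ → ℝ)) : Set (ℕ → ℝ) :=
  {x | x ∈ c0Star ∧ ∃ a ∈ c0Star, ∃ y ∈ S, ∀ n, x n ≤ a n * y n}

/-- The characteristic set of the soft cover. -/
def softCover (S : Set (ℕ → ℝ)) : Set (ℕ → ℝ) :=
  {x | x ∈ c0Star ∧ ∀ a ∈ c0Star, (fun n => a n * x n) ∈ S}

/-- The characteristic set of the pre-arithmetic mean at infinity. -/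
def preMeanInf (S : Set (ℕ → ℝ)) : Set (ℕ → ℝ) :=
  {x | x ∈ ell1Star ∧ amInfSeq x ∈ S}

/-- The characteristic set of the arithmetic mean at infinity. -/
def meanInf (S : Set (ℕ → ℝ)) : Set (ℕ → ℝ) :=
  {x | x ∈ c0Star ∧ ∃ y ∈ S, ∃ M : ℝ, ∀ n, x n ≤ M * amInfSeq y n}

namespace IsCharSet

variable {S : Set (ℕ → ℝ)}

theorem inter {T : Set (ℕ → ℝ)} (hS : IsCharSet S) (hT : IsCharSet T) : IsCharSet (S ∩ T) where
  subset _ h := hS.subset h.1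
  solid hx hy h := ⟨hS.solid hx hy.1 h, hT.solid hx hy.2 h⟩
  add hx hy := ⟨hS.add hx.1 hy.1, hT.add hx.2 hy.2⟩
  double hx := ⟨hS.double hx.1, hT.double hx.2⟩
  finite N hx h := ⟨hS.finite N hx h, hT.finite N hx h⟩

theorem softInterior (hS : IsCharSet S) : IsCharSet (softInterior S) where
  subset _ h := h.1
  solid := fun hx ⟨_, a, ha, z, hz, h1⟩ h => ⟨hx, a, ha, z, hz, fun n => (h n).trans (h1 n)⟩
  add := by
    rintro x y ⟨hx, a, ha, z, hz, h⟩ ⟨hy, b, hb, w, hw, h'⟩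
    refine ⟨c0Star.add hx hy, _, c0Star.add ha hb, _, hS.add hz hw, fun n => ?_⟩
    have h1 := mul_nonneg (c0Star.nonneg ha n) (c0Star.nonneg (hS.subset hw) n)
    have h2 := mul_nonneg (c0Star.nonneg hb n) (c0Star.nonneg (hS.subset hz) n)
    nlinarith [h n, h' n]
  double := fun ⟨hx, a, ha, z, hz, h1⟩ =>
    ⟨c0Star.double hx, _, c0Star.double ha, _, hS.double hz, fun n => h1 (n / 2)⟩
  finite := by
    intro x N hx h
    refine ⟨hx, _, c0Star.inv_succ, fun n => ((N : ℝ) + 1) * x n,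
      hS.finite N (c0Star.smul hx (by positivity)) fun n hn => by simp [h n hn], fun n => ?_⟩
    rw [one_div, inv_mul_eq_div, le_div_iff₀ (by positivity), mul_comm]
    rcases le_or_gt N n with hn | hn
    · simp [h n hn]
    · have : (n : ℝ) ≤ N := by exact_mod_cast hn.le
      exact mul_le_mul_of_nonneg_right (by linarith) (c0Star.nonneg hx n)

theorem softCover (hS : IsCharSet S) : IsCharSet (softCover S) where
  subset _ h := h.1
  solid := fun hx ⟨_, h1⟩ h => ⟨hx, fun a ha => hS.solid (c0Star.mul ha hx) (h1 a ha) fun n =>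
    mul_le_mul_of_nonneg_left (h n) (c0Star.nonneg ha n)⟩
  add := fun ⟨hx, h⟩ ⟨hy, h'⟩ => ⟨c0Star.add hx hy, fun a ha => by
    simpa only [mul_add] using hS.add (h a ha) (h' a ha)⟩
  double := by
    rintro x ⟨hx, h⟩
    refine ⟨c0Star.double hx, fun a ha => ?_⟩
    -- After doubling, this weight is `a (2 * (n / 2))`, which is at least `a n`.
    have hb : (fun n => a (2 * n)) ∈ c0Star := c0Star.comp ha (fun _ _ h => Nat.mul_le_mul_left 2 h)
      (tendsto_id.const_mul_atTop' two_pos)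
    refine hS.solid (c0Star.mul ha (c0Star.double hx)) (hS.double (h _ hb)) fun n => ?_
    exact mul_le_mul_of_nonneg_right (ha.1 (by omega)) (c0Star.nonneg hx _)
  finite := fun N hx h => ⟨hx, fun a ha => hS.finite N (c0Star.mul ha hx) fun n hn => by
    simp [h n hn]⟩

theorem preMeanInf (hS : IsCharSet S) : IsCharSet (preMeanInf S) where
  subset _ h := h.1.1
  solid := fun hx ⟨hy, h1⟩ h => by
    have hx' := ell1Star.of_le hx hy.2 h
    exact ⟨hx', hS.solid (amInfSeq_mem_c0Star hx') h1 (amInfSeq_mono hx'.2 hy.2 h)⟩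
  add := fun ⟨hx, h⟩ ⟨hy, h'⟩ => ⟨ell1Star.add hx hy, by
    simpa only [funext (amInfSeq_add hx.2 hy.2)] using hS.add h h'⟩
  double := by
    rintro x ⟨hx, h⟩
    have hd := ell1Star.double hx
    refine ⟨hd, ?_⟩
    -- `amInfSeq_double_le` excludes `n = 0`; a sequence supported there repairs the bound.
    have h1 : (fun n => if n = 0 then amInfSeq (fun k => x (k / 2)) 0 else 0) ∈ S := by
      refine hS.finite 1 ⟨antitone_nat_of_succ_le fun n => ?_, ?_⟩ fun n hn => if_neg (by omega)
      · rw [if_neg (Nat.succ_ne_zero n)]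
        split_ifs
        · exact c0Star.nonneg (amInfSeq_mem_c0Star hd) 0
        · rfl
      · refine tendsto_const_nhds.congr' ?_
        filter_upwards [eventually_gt_atTop 0] with n hn
        rw [if_neg hn.ne']
    refine hS.solid (amInfSeq_mem_c0Star hd) (hS.add h1 (hS.double (hS.double h))) fun n => ?_
    have h0 := c0Star.nonneg (amInfSeq_mem_c0Star hx) (n / 2 / 2)
    rcases Nat.eq_zero_or_pos n with rfl | hn
    · simpa using h0
    · simpa [hn.ne'] using amInfSeq_double_le hx hn
  finite := fun N hx h => by
    have hx' := ell1Star.isCharSet.finite N hx h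
    refine ⟨hx', hS.finite N (amInfSeq_mem_c0Star hx') fun n hn => ?_⟩
    rw [amInfSeq_eq, tailSum]
    simp [fun j => h (n + 1 + j) (by omega)]

theorem meanInf (hS : IsCharSet S) (h1 : S ⊆ ell1Star) : IsCharSet (meanInf S) where
  subset _ h := h.1
  solid := fun hx ⟨_, z, hz, M, h1⟩ h => ⟨hx, z, hz, M, fun n => (h n).trans (h1 n)⟩
  add := by
    rintro x y ⟨hx, z, hz, M, h⟩ ⟨hy, w, hw, M', h'⟩
    refine ⟨c0Star.add hx hy, _, hS.add hz hw, max M M', fun n => ?_⟩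
    rw [amInfSeq_add (h1 hz).2 (h1 hw).2, mul_add]
    exact add_le_add
      ((h n).trans (mul_le_mul_of_nonneg_right (le_max_left _ _)
        (c0Star.nonneg (amInfSeq_mem_c0Star (h1 hz)) n)))
      ((h' n).trans (mul_le_mul_of_nonneg_right (le_max_right _ _)
        (c0Star.nonneg (amInfSeq_mem_c0Star (h1 hw)) n)))
  double := by
    rintro x ⟨hx, z, hz, M, h⟩
    refine ⟨c0Star.double hx, _, hS.double hz, max M 0, fun n => (h (n / 2)).trans ?_⟩
    exact mul_le_mul (le_max_left _ _) (amInfSeq_half_le (h1 hz) n)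
      (c0Star.nonneg (amInfSeq_mem_c0Star (h1 hz)) _) (le_max_right _ _)
  finite := by
    intro x N hx h
    -- The entry at `N` keeps the tail from `n + 1` at least 1 for every `n < N`.
    have hy : (fun n => if n ≤ N then (1 : ℝ) else 0) ∈ S := by
      refine hS.finite (N + 1) ⟨antitone_nat_of_succ_le fun n => ?_, ?_⟩
        fun n hn => if_neg (by omega)
      · split_ifs
        · rfl
        · omega
        · exact zero_le_one
        · rfl
      · refine tendsto_const_nhds.congr' ?_
        filter_upwards [eventually_gt_atTop N] with n hn
        rw [if_neg (by omega)]
    refine ⟨hx, _, hy, x 0 * ((N : ℝ) + 1), fun n => ?_⟩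
    have hl := h1 hy
    have hx0 := c0Star.nonneg hx
    rcases le_or_gt N n with hn | hn
    · rw [h n hn]
      exact mul_nonneg (mul_nonneg (hx0 0) (by positivity))
        (c0Star.nonneg (amInfSeq_mem_c0Star hl) n)
    · have h2 := (summable_shift hl.2 (n + 1)).le_tsum (N - (n + 1)) fun _ _ =>
        c0Star.nonneg hl.1 _
      rw [if_pos (by omega)] at h2
      rw [amInfSeq_eq, mul_div_assoc', le_div_iff₀ (by positivity), mul_assoc]
      refine mul_le_mul (hx.1 (Nat.zero_le n)) ?_ (by positivity) (hx0 0)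
      have h3 : (n : ℝ) + 1 ≤ N + 1 := by exact_mod_cast (by omega : n + 1 ≤ N + 1)
      exact h3.trans (le_mul_of_one_le_right (by positivity) h2)

end IsCharSet

/-! ### The four relations between characteristic sets -/

section

variable {S : Set (ℕ → ℝ)}

theorem softCover_preMeanInf (hS : IsCharSet S) :
    softCover (preMeanInf S) = preMeanInf (softCover S) := by
  ext x
  constructor
  · rintro ⟨hx, h⟩
    have hx1 : x ∈ ell1Star := ⟨hx, summable_of_forall_mul_summable hx fun a ha => (h a ha).1.2⟩
    refine ⟨hx1, amInfSeq_mem_c0Star hx1, fun a ha => ?_⟩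
    obtain ⟨b, hb, hab⟩ := exists_mul_amInfSeq_le ha hx1
    exact hS.of_le_smul (c0Star.mul ha (amInfSeq_mem_c0Star hx1)) (h b hb).2 2 hab
  · rintro ⟨hx, -, h⟩
    refine ⟨hx.1, fun a ha => ⟨ell1Star.mul_left ha hx, ?_⟩⟩
    exact hS.solid (amInfSeq_mem_c0Star (ell1Star.mul_left ha hx)) (h a ha) (amInfSeq_mul_le ha hx)

theorem softInterior_meanInf (hS : IsCharSet S) :
    softInterior (meanInf (S ∩ ell1Star)) = meanInf (softInterior S ∩ ell1Star) := by
  ext x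
  constructor
  · rintro ⟨hx, a, ha, y, ⟨-, z, hz, M, hy⟩, h⟩
    obtain ⟨b, hb, hab⟩ := exists_mul_amInfSeq_le ha hz.2
    have hbz := ell1Star.mul_left hb hz.2
    refine ⟨hx, _, ⟨⟨hbz.1, b, hb, z, hz.1, fun n => le_rfl⟩, hbz⟩, |M| * 2, fun n => ?_⟩
    calc x n ≤ a n * y n := h n
      _ ≤ a n * (M * amInfSeq z n) := mul_le_mul_of_nonneg_left (hy n) (c0Star.nonneg ha n)
      _ = M * (a n * amInfSeq z n) := by ring
      _ ≤ |M| * (a n * amInfSeq z n) := mul_le_mul_of_nonneg_right (le_abs_self M)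
          (mul_nonneg (c0Star.nonneg ha n) (c0Star.nonneg (amInfSeq_mem_c0Star hz.2) n))
      _ ≤ |M| * (2 * amInfSeq (fun k => b k * z k) n) :=
          mul_le_mul_of_nonneg_left (hab n) (abs_nonneg M)
      _ = _ := by ring
  · rintro ⟨hx, w, ⟨⟨-, a, ha, z, hz, hw⟩, hw1⟩, M, h⟩
    -- `z` need not be summable, so it is replaced by `min z u`, which lies in both `S` and
    -- `ell1Star`. Only the factorization matters here, so the weight is zero.
    obtain ⟨b, hb, u, hu, hwu, -⟩ := exists_le_mul_amInfSeq c0Star.zero hw1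
    have hz0 := hS.subset hz
    have hv0 : (fun n => min (z n) (u n)) ∈ c0Star := c0Star.min hz0 hu.1
    have hv1 : (fun n => min (z n) (u n)) ∈ ell1Star :=
      ell1Star.of_le hv0 hu.2 fun n => min_le_right _ _
    have hc := c0Star.max ha hb
    have hwv : ∀ n, w n ≤ max (a n) (b n) * min (z n) (u n) := fun n => by
      rw [mul_min_of_nonneg _ _ (c0Star.nonneg hc n)]
      exact le_min ((hw n).trans (mul_le_mul_of_nonneg_right (le_max_left _ _)
        (c0Star.nonneg hz0 n))) ((hwu n).trans (mul_le_mul_of_nonneg_right (le_max_right _ _)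
        (c0Star.nonneg hu.1 n)))
    have hm := amInfSeq_mem_c0Star hv1
    refine ⟨hx, _, hc, fun n => |M| * amInfSeq (fun n => min (z n) (u n)) n,
      ⟨c0Star.smul hm (abs_nonneg M), _, ⟨hS.solid hv0 hz fun n => min_le_left _ _, hv1⟩,
        |M|, fun n => le_rfl⟩, fun n => ?_⟩
    calc x n ≤ M * amInfSeq w n := h n
      _ ≤ |M| * amInfSeq w n := mul_le_mul_of_nonneg_right (le_abs_self M)
          (c0Star.nonneg (amInfSeq_mem_c0Star hw1) n)
      _ ≤ |M| * (max (a n) (b n) * amInfSeq (fun n => min (z n) (u n)) n) := by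
          refine mul_le_mul_of_nonneg_left ?_ (abs_nonneg M)
          exact (amInfSeq_mono hw1.2 (ell1Star.mul_left hc hv1).2 hwv n).trans
            (amInfSeq_mul_le hc hv1 n)
      _ = _ := by ring

theorem meanInf_softCover_subset :
    meanInf (softCover S ∩ ell1Star) ⊆ softCover (meanInf (S ∩ ell1Star)) := by
  rintro x ⟨hx, y, ⟨⟨-, hy⟩, hy1⟩, M, h⟩
  refine ⟨hx, fun a ha => ?_⟩
  obtain ⟨b, hb, hab⟩ := exists_mul_amInfSeq_le ha hy1
  refine ⟨c0Star.mul ha hx, _, ⟨hy b hb, ell1Star.mul_left hb hy1⟩, |M| * 2, fun n => ?_⟩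
  calc a n * x n ≤ a n * (M * amInfSeq y n) :=
        mul_le_mul_of_nonneg_left (h n) (c0Star.nonneg ha n)
    _ = M * (a n * amInfSeq y n) := by ring
    _ ≤ |M| * (a n * amInfSeq y n) := mul_le_mul_of_nonneg_right (le_abs_self M)
        (mul_nonneg (c0Star.nonneg ha n) (c0Star.nonneg (amInfSeq_mem_c0Star hy1) n))
    _ ≤ |M| * (2 * amInfSeq (fun k => b k * y k) n) :=
        mul_le_mul_of_nonneg_left (hab n) (abs_nonneg M)
    _ = _ := by ring

theorem softInterior_preMeanInf (hS : IsCharSet S) :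
    softInterior (preMeanInf S) = preMeanInf (softInterior S) := by
  ext x
  constructor
  · rintro ⟨hx, a, ha, y, ⟨hy, hyS⟩, h⟩
    have hay := ell1Star.mul_left ha hy
    have hx1 := ell1Star.of_le hx hay.2 h
    exact ⟨hx1, amInfSeq_mem_c0Star hx1, a, ha, _, hyS, fun n =>
      (amInfSeq_mono hx1.2 hay.2 h n).trans (amInfSeq_mul_le ha hy n)⟩
  · rintro ⟨hx, -, a, ha, z, hz, h⟩
    -- Adding a positive null sequence makes the weight cancellable at the end.
    have ha' := c0Star.add ha c0Star.inv_succ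
    obtain ⟨b, hb, y, hy, hxy, C, hC⟩ := exists_le_mul_amInfSeq ha' hx
    refine ⟨hx.1, b, hb, y, ⟨hy, hS.of_le_smul (amInfSeq_mem_c0Star hy) hz |C| fun n => ?_⟩, hxy⟩
    have hz0 := c0Star.nonneg (hS.subset hz) n
    have hp : 0 < a n + 1 / ((n : ℝ) + 1) :=
      add_pos_of_nonneg_of_pos (c0Star.nonneg ha n) (by positivity)
    refine le_of_mul_le_mul_left ?_ hp
    calc (a n + 1 / ((n : ℝ) + 1)) * amInfSeq y n ≤ C * amInfSeq x n := hC n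
      _ ≤ |C| * amInfSeq x n := mul_le_mul_of_nonneg_right (le_abs_self C)
          (c0Star.nonneg (amInfSeq_mem_c0Star hx) n)
      _ ≤ |C| * ((a n + 1 / ((n : ℝ) + 1)) * z n) := by
          refine mul_le_mul_of_nonneg_left ((h n).trans ?_) (abs_nonneg C)
          exact mul_le_mul_of_nonneg_right (le_add_of_nonneg_right (by positivity)) hz0
      _ = _ := by ring

end

variable {H : Type*} [NormedAddCommGroup H] [InnerProductSpace ℂ H]

/-! ### Inequalities for `s`-numbers -/

theorem sNumbers_bddBelow (X : H →L[ℂ] H) (n : ℕ) :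
    BddBelow (Set.range fun F : {F : H →L[ℂ] H //
      LinearMap.rank (F : H →ₗ[ℂ] H) ≤ (n : Cardinal)} => ‖X - F‖) :=
  ⟨0, by rintro _ ⟨F, rfl⟩; exact norm_nonneg _⟩

theorem sNumbers_le (X : H →L[ℂ] H) {n : ℕ} (F : H →L[ℂ] H)
    (hF : LinearMap.rank (F : H →ₗ[ℂ] H) ≤ (n : Cardinal)) : sNumbers X n ≤ ‖X - F‖ :=
  ciInf_le (sNumbers_bddBelow X n) ⟨F, hF⟩

instance nonempty_rank_le (n : ℕ) :
    Nonempty {F : H →L[ℂ] H // LinearMap.rank (F : H →ₗ[ℂ] H) ≤ (n : Cardinal)} :=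
  ⟨⟨0, by simp⟩⟩

theorem sNumbers_nonneg (X : H →L[ℂ] H) (n : ℕ) : 0 ≤ sNumbers X n :=
  le_ciInf fun _ => norm_nonneg _

theorem sNumbers_zero (n : ℕ) : sNumbers (0 : H →L[ℂ] H) n = 0 :=
  le_antisymm ((sNumbers_le 0 0 (by simp)).trans (by simp)) (sNumbers_nonneg _ _)

theorem sNumbers_mul_le_left (A X : H →L[ℂ] H) (n : ℕ) :
    sNumbers (A * X) n ≤ ‖A‖ * sNumbers X n := by
  rw [sNumbers, sNumbers, Real.mul_iInf_of_nonneg (norm_nonneg A)]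
  refine le_ciInf fun F => (sNumbers_le (A * X) (A * F.1) ?_).trans ?_
  · exact (LinearMap.rank_comp_le_right (F.1 : H →ₗ[ℂ] H) (A : H →ₗ[ℂ] H)).trans F.2
  · rw [← mul_sub]
    exact norm_mul_le _ _

theorem sNumbers_mul_le_right (X B : H →L[ℂ] H) (n : ℕ) :
    sNumbers (X * B) n ≤ ‖B‖ * sNumbers X n := by
  rw [sNumbers, sNumbers, Real.mul_iInf_of_nonneg (norm_nonneg B)]
  refine le_ciInf fun F => (sNumbers_le (X * B) (F.1 * B) ?_).trans ?_
  · exact (LinearMap.rank_comp_le_left (B : H →ₗ[ℂ] H) (F.1 : H →ₗ[ℂ] H)).trans F.2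
  · rw [← sub_mul, mul_comm ‖B‖]
    exact norm_mul_le _ _

/-- Near-optimal approximants of rank at most `n / 2` add up to one of rank at most `n`. The halved
index is why `IsCharSet` includes doubling. -/
theorem sNumbers_add_le (X Y : H →L[ℂ] H) (n : ℕ) :
    sNumbers (X + Y) n ≤ sNumbers X (n / 2) + sNumbers Y (n / 2) := by
  refine le_of_forall_pos_le_add fun ε hε => ?_
  obtain ⟨F, hF⟩ := exists_lt_of_ciInf_lt (lt_add_of_pos_right (sNumbers X (n / 2)) (half_pos hε))
  obtain ⟨G, hG⟩ := exists_lt_of_ciInf_lt (lt_add_of_pos_right (sNumbers Y (n / 2)) (half_pos hε))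
  have hr : LinearMap.rank ((F.1 + G.1 : H →L[ℂ] H) : H →ₗ[ℂ] H) ≤ (n : Cardinal) := by
    refine (LinearMap.rank_add_le (F.1 : H →ₗ[ℂ] H) (G.1 : H →ₗ[ℂ] H)).trans
      ((add_le_add F.2 G.2).trans ?_)
    exact_mod_cast (by omega : n / 2 + n / 2 ≤ n)
  have h1 := sNumbers_le (X + Y) _ hr
  rw [add_sub_add_comm] at h1
  have h2 := norm_add_le (X - F.1) (Y - G.1)
  linarith

theorem sNumbers_neg_le (X : H →L[ℂ] H) (n : ℕ) : sNumbers (-X) n ≤ sNumbers X n := by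
  refine le_ciInf fun F => (sNumbers_le (-X) (-F.1) ?_).trans_eq ?_
  · refine le_trans ?_ F.2
    refine Submodule.rank_mono ?_
    rintro _ ⟨v, rfl⟩
    exact ⟨-v, by simp⟩
  · rw [← norm_neg]
    congr 1
    abel

/-- The ideal of operators whose `s`-numbers are dominated by a member of `S`. -/
def dominatedIdeal {S : Set (ℕ → ℝ)} (hS : IsCharSet S) : TwoSidedIdeal (H →L[ℂ] H) :=
  TwoSidedIdeal.mk' {X | ∃ y ∈ S, ∀ n, sNumbers X n ≤ y n}
    ⟨_, hS.finite 0 c0Star.zero fun _ _ => rfl, fun n => (sNumbers_zero n).le⟩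
    (fun ⟨_, hy, h⟩ ⟨_, hz, h'⟩ => ⟨_, hS.double (hS.add hy hz), fun n =>
      (sNumbers_add_le _ _ n).trans (add_le_add (h _) (h' _))⟩)
    (fun ⟨y, hy, h⟩ => ⟨y, hy, fun n => (sNumbers_neg_le _ n).trans (h n)⟩)
    (fun {A X} ⟨_, hy, h⟩ => ⟨_, hS.of_le_smul (c0Star.smul (hS.subset hy) (norm_nonneg A)) hy
      ‖A‖ fun _ => le_rfl, fun n => (sNumbers_mul_le_left A X n).trans
        (mul_le_mul_of_nonneg_left (h n) (norm_nonneg A))⟩)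
    (fun {X B} ⟨_, hy, h⟩ => ⟨_, hS.of_le_smul (c0Star.smul (hS.subset hy) (norm_nonneg B)) hy
      ‖B‖ fun _ => le_rfl, fun n => (sNumbers_mul_le_right X B n).trans
        (mul_le_mul_of_nonneg_left (h n) (norm_nonneg B))⟩)

theorem mem_dominatedIdeal {S : Set (ℕ → ℝ)} (hS : IsCharSet S) {X : H →L[ℂ] H} :
    X ∈ dominatedIdeal hS ↔ ∃ y ∈ S, ∀ n, sNumbers X n ≤ y n :=
  TwoSidedIdeal.mem_mk' ..

/-! ### Diagonal operators -/

/-- `X` acts diagonally on the basis `b`, with real eigenvalues `x n`. -/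
def DiagOn (b : HilbertBasis ℕ ℂ H) (X : H →L[ℂ] H) (x : ℕ → ℝ) : Prop :=
  ∀ n, X (b n) = (x n : ℂ) • b n

theorem ext_on_basis (b : HilbertBasis ℕ ℂ H) {X Y : H →L[ℂ] H} (h : ∀ n, X (b n) = Y (b n)) :
    X = Y :=
  ContinuousLinearMap.ext_on
    ((Submodule.dense_iff_topologicalClosure_eq_top).2 b.dense_span) (by rintro _ ⟨n, rfl⟩; exact h n)

theorem DiagOn.unique {b : HilbertBasis ℕ ℂ H} {X Y : H →L[ℂ] H} {x : ℕ → ℝ} (hX : DiagOn b X x)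
    (hY : DiagOn b Y x) : X = Y :=
  ext_on_basis b fun n => (hX n).trans (hY n).symm

/-- This is coordinatewise multiplication on `ℓ²`, transported along the unitary `b.repr`. -/
theorem exists_diagOn (b : HilbertBasis ℕ ℂ H) {x : ℕ → ℝ} {K : ℝ} (hK : 0 ≤ K)
    (hx : ∀ n, |x n| ≤ K) : ∃ X : H →L[ℂ] H, DiagOn b X x ∧ ‖X‖ ≤ K := by
  have hT : ∀ n, ‖(x n : ℂ) • ContinuousLinearMap.id ℂ ℂ‖ ≤ K := fun n => by
    rw [norm_smul, ContinuousLinearMap.norm_id, mul_one, Complex.norm_real]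
    exact hx n
  set T := lp.mapCLM (E := fun _ : ℕ => ℂ) (F := fun _ : ℕ => ℂ) 2
    (fun n => (x n : ℂ) • ContinuousLinearMap.id ℂ ℂ) hK hT with hTdef
  have hTn : ‖T‖ ≤ K := lp.norm_mapCLM_le 2 _ hK hT
  refine ⟨(b.repr.symm.toContinuousLinearEquiv : _ →L[ℂ] H) ∘L T ∘L
    (b.repr.toContinuousLinearEquiv : H →L[ℂ] _), fun n => ?_, ?_⟩
  · have : T (b.repr (b n)) = (x n : ℂ) • b.repr (b n) := by
      classical
      rw [b.repr_self]
      ext i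
      simp only [hTdef, lp.mapCLM_apply_coe, lp.coeFn_smul, Pi.smul_apply]
      by_cases h : i = n
      · subst h
        simp
      · simp [h]
    simp only [ContinuousLinearMap.comp_apply, ContinuousLinearEquiv.coe_coe,
      LinearIsometryEquiv.coe_toContinuousLinearEquiv]
    rw [this, map_smul, LinearIsometryEquiv.symm_apply_apply]
  · refine ContinuousLinearMap.opNorm_le_bound _ hK fun v => ?_
    simp only [ContinuousLinearMap.comp_apply, ContinuousLinearEquiv.coe_coe,
      LinearIsometryEquiv.coe_toContinuousLinearEquiv, LinearIsometryEquiv.norm_map]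
    exact (T.le_opNorm _).trans
      (by rw [LinearIsometryEquiv.norm_map]; exact mul_le_mul_of_nonneg_right hTn (norm_nonneg v))

theorem exists_diagOn_of_mem (b : HilbertBasis ℕ ℂ H) {x : ℕ → ℝ} (hx : x ∈ c0Star) :
    ∃ X : H →L[ℂ] H, DiagOn b X x := by
  obtain ⟨X, hX, -⟩ := exists_diagOn b (c0Star.nonneg hx 0) (x := x) fun n => by
    rw [abs_of_nonneg (c0Star.nonneg hx n)]
    exact hx.1 (Nat.zero_le n)
  exact ⟨X, hX⟩

theorem DiagOn.add {b : HilbertBasis ℕ ℂ H} {X Y : H →L[ℂ] H} {x y : ℕ → ℝ} (hX : DiagOn b X x)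
    (hY : DiagOn b Y y) : DiagOn b (X + Y) fun n => x n + y n := fun n => by
  simp [hX n, hY n, add_smul]

/-- The rank-one operator `v ↦ ⟪w, v⟫ u`. -/
noncomputable def rankOneOp (u w : H) : H →L[ℂ] H := (innerSL ℂ w).smulRight u

theorem rankOneOp_apply (u w v : H) : rankOneOp u w v = inner ℂ w v • u := rfl

theorem sum_rankOneOp_apply_basis (b : HilbertBasis ℕ ℂ H) (x : ℕ → ℝ) (N k : ℕ) :
    (∑ i ∈ Finset.range N, rankOneOp ((x i : ℂ) • b i) (b i)) (b k) =
      if k < N then (x k : ℂ) • b k else 0 := by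
  have h := orthonormal_iff_ite.1 b.orthonormal
  simp [rankOneOp_apply, h]

/-- Cutting off after `n` entries gives the upper bound. For the lower bound, an operator of rank at
most `n` kills a nonzero vector in the span of the first `n + 1` basis vectors, where `X` is bounded
below by `x n`. -/
theorem DiagOn.sNumbers_eq {b : HilbertBasis ℕ ℂ H} {X : H →L[ℂ] H} {x : ℕ → ℝ}
    (hX : DiagOn b X x) (hx : x ∈ c0Star) : sNumbers X = x := by
  have hx0 := c0Star.nonneg hx
  ext n
  refine le_antisymm ?_ (le_ciInf fun F => ?_)
  · set F := ∑ i ∈ Finset.range n, rankOneOp ((x i : ℂ) • b i) (b i) with hF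
    have hr : LinearMap.rank (F : H →ₗ[ℂ] H) ≤ (n : Cardinal) := by
      classical
      have h1 : LinearMap.range (F : H →ₗ[ℂ] H) ≤
          Submodule.span ℂ ((Finset.range n).image b : Set H) := by
        rintro _ ⟨v, rfl⟩
        simp only [hF, ContinuousLinearMap.coe_coe, sum_apply,
          rankOneOp_apply]
        refine Submodule.sum_mem _ fun i hi => Submodule.smul_mem _ _ (Submodule.smul_mem _ _
          (Submodule.subset_span ?_))
        exact Finset.mem_coe.2 (Finset.mem_image_of_mem _ hi)
      refine (Submodule.rank_mono h1).trans ((rank_span_finset_le _).trans ?_)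
      exact_mod_cast Finset.card_image_le.trans (Finset.card_range n).le
    refine (sNumbers_le X F hr).trans ?_
    obtain ⟨Y, hY, hYn⟩ := exists_diagOn b (x := fun k => if k < n then 0 else x k) (hx0 n)
      fun k => by
        split_ifs with h
        · simpa using hx0 n
        · rw [abs_of_nonneg (hx0 k)]
          exact hx.1 (not_lt.1 h)
    have : X - F = Y := ext_on_basis b fun k => by
      rw [sub_apply, hX k, sum_rankOneOp_apply_basis, hY k]
      by_cases h : k < n <;> simp [h]
    rwa [this]
  · rcases (hx0 n).eq_or_lt with h0 | hpos
    · rw [← h0]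
      exact norm_nonneg _
    set R := LinearMap.range (F.1 : H →ₗ[ℂ] H)
    have hRr : Module.rank ℂ R ≤ (n : Cardinal) := F.2
    have : Module.Finite ℂ R := Module.rank_lt_aleph0_iff.1
      (hRr.trans_lt (Cardinal.natCast_lt_aleph0))
    set G : (Fin (n + 1) → ℂ) →ₗ[ℂ] R := (F.1 : H →ₗ[ℂ] H).rangeRestrict ∘ₗ
      Fintype.linearCombination ℂ (fun i : Fin (n + 1) => b i)
    have hker : LinearMap.ker G ≠ ⊥ := LinearMap.ker_ne_bot_of_finrank_lt (by
      rw [Module.finrank_fin_fun]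
      exact Nat.lt_succ_of_le (Module.finrank_le_of_rank_le hRr))
    obtain ⟨c, hc, hc0⟩ := (Submodule.ne_bot_iff _).1 hker
    set v : H := ∑ i : Fin (n + 1), c i • b i with hv
    have hFv : F.1 v = 0 := congrArg Subtype.val (LinearMap.mem_ker.1 hc)
    have hv0 : v ≠ 0 := fun h => hc0 (funext fun i => by
      have hli : LinearIndependent ℂ fun i : Fin (n + 1) => b i :=
        b.orthonormal.linearIndependent.comp _ Fin.val_injective
      exact Fintype.linearIndependent_iff.1 hli c h i)
    -- `E` inverts `X` on that span with norm at most `(x n)⁻¹`, which encodes the lower bound for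
    -- `X`.
    obtain ⟨E, hE, hEn⟩ := exists_diagOn b (x := fun k => if k < n + 1 then (x k)⁻¹ else 0)
      (inv_nonneg.2 (hx0 n)) fun k => by
        split_ifs with h
        · rw [abs_of_nonneg (inv_nonneg.2 (hx0 k))]
          exact inv_anti₀ hpos (hx.1 (by omega))
        · simpa using hx0 n
    have hEX : E (X v) = v := by
      simp only [hv, map_sum, map_smul]
      refine Finset.sum_congr rfl fun i _ => ?_
      have hi : x i ≠ 0 := (hpos.trans_le (hx.1 (by omega))).ne'
      rw [hX, map_smul, hE]
      dsimp only
      rw [if_pos i.2, smul_smul (x i : ℂ), Complex.ofReal_inv,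
        mul_inv_cancel₀ (by exact_mod_cast hi), one_smul]
    have h1 : ‖v‖ ≤ (x n)⁻¹ * ‖(X - F.1) v‖ := by
      rw [sub_apply, hFv, sub_zero]
      calc ‖v‖ = ‖E (X v)‖ := by rw [hEX]
        _ ≤ ‖E‖ * ‖X v‖ := E.le_opNorm _
        _ ≤ _ := mul_le_mul_of_nonneg_right hEn (norm_nonneg _)
    rw [inv_mul_eq_div, le_div_iff₀ hpos] at h1
    refine le_of_mul_le_mul_left ?_ (norm_pos_iff.2 hv0)
    rw [mul_comm _ ‖X - F.1‖]
    exact h1.trans ((X - F.1).le_opNorm v)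

theorem mem_charSet_of_diagOn {b : HilbertBasis ℕ ℂ H} {J : TwoSidedIdeal (H →L[ℂ] H)}
    {X : H →L[ℂ] H} {x : ℕ → ℝ} (hX : DiagOn b X x) (hx : x ∈ c0Star) (hXJ : X ∈ J) :
    x ∈ charSet J :=
  ⟨hx, X, hXJ, hX.sNumbers_eq hx⟩

/-- An ideal generated by a characteristic set has that characteristic set. -/
theorem charSet_idealOf (b : HilbertBasis ℕ ℂ H) {S : Set (ℕ → ℝ)} (hS : IsCharSet S) :
    charSet (idealOf S : TwoSidedIdeal (H →L[ℂ] H)) = S := by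
  ext x
  constructor
  · rintro ⟨hx, X, hX, rfl⟩
    have hle : (idealOf S : TwoSidedIdeal (H →L[ℂ] H)) ≤ dominatedIdeal hS := by
      refine TwoSidedIdeal.span_le.2 ?_
      rintro Y ⟨y, hy, b', hb'⟩
      refine (mem_dominatedIdeal hS).2 ⟨y, hy, fun n => ?_⟩
      rw [DiagOn.sNumbers_eq (b := b') hb' (hS.subset hy)]
    obtain ⟨y, hy, h⟩ := (mem_dominatedIdeal hS).1 (hle hX)
    exact hS.solid hx hy h
  · intro hx
    obtain ⟨X, hX⟩ := exists_diagOn_of_mem b (hS.subset hx)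
    exact mem_charSet_of_diagOn hX (hS.subset hx) (TwoSidedIdeal.subset_span ⟨x, hx, b, hX⟩)

/-! ### Ideals and their diagonal operators -/

/-- `Y` is `X` times the bounded diagonal operator of quotients `y n / x n`; where `x n = 0`, also
`y n = 0`. -/
theorem DiagOn.mem_of_le {b : HilbertBasis ℕ ℂ H} {J : TwoSidedIdeal (H →L[ℂ] H)}
    {X Y : H →L[ℂ] H} {x y : ℕ → ℝ} (hX : DiagOn b X x) (hY : DiagOn b Y y) (hXJ : X ∈ J)
    {M : ℝ} (hM : 0 ≤ M) (hx : ∀ n, 0 ≤ x n) (h : ∀ n, |y n| ≤ M * x n) : Y ∈ J := by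
  obtain ⟨Z, hZ, -⟩ := exists_diagOn b (x := fun n => y n / x n) hM fun n => by
    rw [abs_div, abs_of_nonneg (hx n)]
    exact div_le_of_le_mul₀ (hx n) hM (h n)
  have : Y = Z * X := ext_on_basis b fun n => by
    rw [mul_apply_eq_comp, hX, map_smul, hZ, hY, smul_smul, ← Complex.ofReal_mul]
    congr 2
    rcases eq_or_ne (x n) 0 with h0 | h0
    · have := h n
      rw [h0, mul_zero, abs_nonpos_iff] at this
      simp [this, h0]
    · exact (mul_div_cancel₀ _ h0).symm
  rw [this]
  exact J.mul_mem_left _ _ hXJ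

theorem rankOneOp_mem [CompleteSpace H] {J : TwoSidedIdeal (H →L[ℂ] H)} {X : H →L[ℂ] H}
    (hX : X ∈ J) (hX0 : X ≠ 0) (u w : H) : rankOneOp u w ∈ J := by
  obtain ⟨a, ha⟩ : ∃ a, X a ≠ 0 := by
    by_contra! h
    exact hX0 (ContinuousLinearMap.ext h)
  have hn : inner ℂ (X a) (X a) ≠ (0 : ℂ) := inner_self_ne_zero.2 ha
  have : rankOneOp u w =
      rankOneOp ((inner ℂ (X a) (X a) : ℂ)⁻¹ • u) (X a) * X * rankOneOp a w := by
    ext v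
    simp only [mul_apply_eq_comp, rankOneOp_apply, map_smul,
      smul_smul]
    rw [mul_inv_cancel₀ hn, mul_one]
  rw [this]
  exact J.mul_mem_right _ _ (J.mul_mem_left _ _ hX)

theorem DiagOn.mem_of_finite [CompleteSpace H] {b : HilbertBasis ℕ ℂ H}
    {J : TwoSidedIdeal (H →L[ℂ] H)} {X D : H →L[ℂ] H} {x : ℕ → ℝ} (hX : X ∈ J) (hX0 : X ≠ 0)
    (hD : DiagOn b D x) {N : ℕ} (h : ∀ n, N ≤ n → x n = 0) : D ∈ J := by
  have : D = ∑ i ∈ Finset.range N, rankOneOp ((x i : ℂ) • b i) (b i) :=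
    ext_on_basis b fun k => by
      rw [hD, sum_rankOneOp_apply_basis]
      split_ifs with hk
      · rfl
      · simp [h k (not_lt.1 hk)]
  rw [this]
  exact sum_mem fun i _ => rankOneOp_mem hX hX0 _ _

/-- An orthonormal sequence gives an isometry mapping the basis onto it. -/
theorem exists_isometry [CompleteSpace H] (b : HilbertBasis ℕ ℂ H) {e : ℕ → H}
    (he : Orthonormal ℂ e) : ∃ V : H →L[ℂ] H, (∀ n, V (b n) = e n) ∧
      (∀ n, ContinuousLinearMap.adjoint V (e n) = b n) ∧
      ∀ v, (∀ n, inner ℂ (e n) v = (0 : ℂ)) → ContinuousLinearMap.adjoint V v = 0 := by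
  set L := he.orthogonalFamily.linearIsometry
  set V : H →L[ℂ] H := L.toContinuousLinearMap ∘L
    (b.repr.toContinuousLinearEquiv : H →L[ℂ] _) with hV
  have hVb : ∀ n, V (b n) = e n := fun n => by
    classical
    simp only [hV, ContinuousLinearMap.comp_apply, ContinuousLinearEquiv.coe_coe,
      LinearIsometryEquiv.coe_toContinuousLinearEquiv, LinearIsometry.coe_toContinuousLinearMap]
    rw [b.repr_self, OrthogonalFamily.linearIsometry_apply_single]
    simp
  have hext : ∀ v w : H, (∀ n, inner ℂ (b n) v = (inner ℂ (b n) w : ℂ)) → v = w := fun v w h => by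
    refine b.repr.injective (lp.ext (funext fun n => ?_))
    rw [b.repr_apply_apply, b.repr_apply_apply, h]
  refine ⟨V, hVb, fun n => hext _ _ fun m => ?_, fun v hv => hext _ _ fun m => ?_⟩
  · rw [ContinuousLinearMap.adjoint_inner_right, hVb, orthonormal_iff_ite.1 he,
      orthonormal_iff_ite.1 b.orthonormal]
  · rw [ContinuousLinearMap.adjoint_inner_right, hVb, hv, inner_zero_right]

/-- With isometries `V`, `W` onto the spans of the even and odd basis vectors, `D = V X V* + W X
W*`. -/
theorem DiagOn.double_mem [CompleteSpace H] {b : HilbertBasis ℕ ℂ H}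
    {J : TwoSidedIdeal (H →L[ℂ] H)} {X D : H →L[ℂ] H} {x : ℕ → ℝ} (hX : DiagOn b X x)
    (hXJ : X ∈ J) (hD : DiagOn b D fun n => x (n / 2)) : D ∈ J := by
  have hb := orthonormal_iff_ite.1 b.orthonormal
  obtain ⟨V, hV, hV1, hV2⟩ := exists_isometry b
    (b.orthonormal.comp (fun n => 2 * n) fun m n h => by dsimp only at h; omega)
  obtain ⟨W, hW, hW1, hW2⟩ := exists_isometry b
    (b.orthonormal.comp (fun n => 2 * n + 1) fun m n h => by dsimp only at h; omega)
  simp only [Function.comp_apply] at hV hV1 hV2 hW hW1 hW2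
  have : D = V * X * ContinuousLinearMap.adjoint V + W * X * ContinuousLinearMap.adjoint W := by
    refine ext_on_basis b fun k => ?_
    rw [hD]
    simp only [add_apply, mul_apply_eq_comp]
    obtain ⟨m, rfl | rfl⟩ := Nat.even_or_odd' k
    · rw [hV1, hW2 _ fun n => by rw [hb, if_neg (by omega)], hX, map_smul, hV]
      simp
    · rw [hW1, hV2 _ fun n => by rw [hb, if_neg (by omega)], hX, map_smul, hW]
      simp [show (2 * m + 1) / 2 = m by omega]
  rw [this]
  exact J.add_mem (J.mul_mem_right _ _ (J.mul_mem_left _ _ hXJ))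
    (J.mul_mem_right _ _ (J.mul_mem_left _ _ hXJ))

/-- `X` composed with the projection onto `K` has rank at most `dim K`, so the remainder has norm at
least the `s`-number. Halving gives slack, as the norm need not be attained. -/
theorem exists_unit_orthogonal {X : H →L[ℂ] H} (hs : ∀ n, 0 < sNumbers X n)
    (K : Submodule ℂ H) [FiniteDimensional ℂ K] :
    ∃ e ∈ Kᗮ, ‖e‖ = 1 ∧ sNumbers X (Module.finrank ℂ K) / 2 ≤ ‖X e‖ := by
  set s := sNumbers X (Module.finrank ℂ K)
  have hr : LinearMap.rank ((X * K.starProjection : H →L[ℂ] H) : H →ₗ[ℂ] H) ≤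
      (Module.finrank ℂ K : Cardinal) := by
    refine (LinearMap.rank_comp_le_right (K.starProjection : H →ₗ[ℂ] H) (X : H →ₗ[ℂ] H)).trans ?_
    rw [Module.finrank_eq_rank]
    refine Submodule.rank_mono ?_
    rintro _ ⟨v, rfl⟩
    exact K.starProjection_apply_mem v
  have hlt : s / 2 < ‖X - X * K.starProjection‖ :=
    (half_lt_self (hs _)).trans_le (sNumbers_le X _ hr)
  obtain ⟨v, hv⟩ : ∃ v, s / 2 * ‖v‖ < ‖(X - X * K.starProjection) v‖ := by
    by_contra! h
    exact hlt.not_ge (ContinuousLinearMap.opNorm_le_bound _ (half_pos (hs _)).le h)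
  set w := v - K.starProjection v with hw
  have hXw : (X - X * K.starProjection) v = X w := by simp [hw]
  rw [hXw] at hv
  have hwK : w ∈ Kᗮ := K.sub_starProjection_mem_orthogonal v
  have hwv : ‖w‖ ≤ ‖v‖ := by
    have h1 : w = Kᗮ.starProjection v := by simp [hw, Submodule.starProjection_orthogonal]
    rw [h1]
    exact Kᗮ.norm_starProjection_apply_le v
  have hw0 : 0 < ‖w‖ := norm_pos_iff.2 fun h => by
    rw [h, map_zero, norm_zero] at hv
    exact hv.not_ge (mul_nonneg (half_pos (hs _)).le (norm_nonneg v))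
  refine ⟨((‖w‖⁻¹ : ℝ) : ℂ) • w, Kᗮ.smul_mem _ hwK, ?_, ?_⟩
  · rw [norm_smul, Complex.norm_real, norm_inv, norm_norm, inv_mul_cancel₀ hw0.ne']
  · rw [map_smul, norm_smul, Complex.norm_real, norm_inv, norm_norm, inv_mul_eq_div,
      le_div_iff₀ hw0]
    exact (mul_le_mul_of_nonneg_left hwv (half_pos (hs _)).le).trans hv.le

/-- An operator of infinite rank maps some orthonormal sequence to an orthogonal one, with norms
bounded below by its `s`-numbers. -/
theorem exists_orthonormal_orthogonal_image [CompleteSpace H] {X : H →L[ℂ] H}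
    (hs : ∀ n, 0 < sNumbers X n) (hanti : Antitone (sNumbers X)) :
    ∃ e : ℕ → H, Orthonormal ℂ e ∧ (∀ m n, m ≠ n → inner ℂ (X (e m)) (X (e n)) = (0 : ℂ)) ∧
      ∀ n, sNumbers X (2 * n) / 2 ≤ ‖X (e n)‖ := by
  choose f hfK hf1 hfX using fun K : {K : Submodule ℂ H // FiniteDimensional ℂ K} =>
    have := K.2
    exists_unit_orthogonal hs K.1
  set A := ContinuousLinearMap.adjoint X
  -- Orthogonality to `A (X e)` makes later images orthogonal to `X e`. Each step adds at most two
  -- dimensions, hence the index `2 * n`.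
  set next : {K : Submodule ℂ H // FiniteDimensional ℂ K} →
      {K : Submodule ℂ H // FiniteDimensional ℂ K} := fun K =>
    ⟨K.1 ⊔ (Submodule.span ℂ {f K} ⊔ Submodule.span ℂ {A (X (f K))}), by
      have := K.2
      infer_instance⟩
  set K : ℕ → {K : Submodule ℂ H // FiniteDimensional ℂ K} := fun n =>
    next^[n] ⟨⊥, inferInstance⟩
  have hK : ∀ n, K (n + 1) = next (K n) := fun n => Function.iterate_succ_apply' _ _ _
  have hKle : ∀ n, (K n).1 ≤ (K (n + 1)).1 := fun n => by
    rw [hK]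
    exact le_sup_left
  have hKmono : Monotone fun n => (K n).1 := monotone_nat_of_le_succ hKle
  have hsp : ∀ v : H, Module.finrank ℂ (Submodule.span ℂ {v}) ≤ 1 := fun v =>
    (finrank_span_le_card {v}).trans (by simp)
  have hKr : ∀ n, Module.finrank ℂ (K n).1 ≤ 2 * n := fun n => by
    induction n with
    | zero => exact (finrank_bot ℂ H).le
    | succ n ih =>
      rw [hK]
      have := (K n).2
      refine (Submodule.finrank_add_le_finrank_add_finrank _ _).trans ?_
      have h1 := Submodule.finrank_add_le_finrank_add_finrank (Submodule.span ℂ {f (K n)})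
        (Submodule.span ℂ {A (X (f (K n)))})
      have h2 := hsp (f (K n))
      have h3 := hsp (A (X (f (K n))))
      omega
  have hmem : ∀ m n, m < n → f (K m) ∈ (K n).1 ∧ A (X (f (K m))) ∈ (K n).1 := fun m n hmn => by
    have h1 : (K (m + 1)).1 ≤ (K n).1 := hKmono hmn
    rw [hK] at h1
    exact ⟨h1 (Submodule.mem_sup_right (Submodule.mem_sup_left
        (Submodule.mem_span_singleton_self _))),
      h1 (Submodule.mem_sup_right (Submodule.mem_sup_right
        (Submodule.mem_span_singleton_self _)))⟩
  have hort : ∀ m n, m < n → inner ℂ (f (K m)) (f (K n)) = (0 : ℂ) := fun m n hmn =>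
    (Submodule.mem_orthogonal _ _).1 (hfK (K n)) _ (hmem m n hmn).1
  have hortX : ∀ m n, m < n → inner ℂ (X (f (K m))) (X (f (K n))) = (0 : ℂ) := fun m n hmn => by
    rw [← ContinuousLinearMap.adjoint_inner_left]
    exact (Submodule.mem_orthogonal _ _).1 (hfK (K n)) _ (hmem m n hmn).2
  refine ⟨fun n => f (K n), ⟨fun n => hf1 _, fun m n hmn => ?_⟩, fun m n hmn => ?_, fun n => ?_⟩
  · rcases hmn.lt_or_gt with h | h
    · exact hort m n h
    · exact inner_eq_zero_symm.1 (hort n m h)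
  · rcases hmn.lt_or_gt with h | h
    · exact hortX m n h
    · exact inner_eq_zero_symm.1 (hortX n m h)
  · exact (div_le_div_of_nonneg_right (hanti (hKr n)) zero_le_two).trans (hfX (K n))

/-- The diagonal operator of the `s`-numbers of an operator lies in every ideal containing it. -/
theorem DiagOn.mem_of_sNumbers [CompleteSpace H] {b : HilbertBasis ℕ ℂ H}
    {J : TwoSidedIdeal (H →L[ℂ] H)} {X D : H →L[ℂ] H} (hXJ : X ∈ J)
    (hX : sNumbers X ∈ c0Star) (hD : DiagOn b D (sNumbers X)) : D ∈ J := by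
  by_cases hs : ∀ n, 0 < sNumbers X n
  · obtain ⟨e, he, heX, hle⟩ := exists_orthonormal_orthogonal_image hs hX.1
    have hpos : ∀ n, 0 < ‖X (e n)‖ := fun n => (half_pos (hs _)).trans_le (hle n)
    have hf : Orthonormal ℂ fun n => ((‖X (e n)‖⁻¹ : ℝ) : ℂ) • X (e n) := by
      refine ⟨fun n => ?_, fun m n hmn => ?_⟩
      · rw [norm_smul, Complex.norm_real, norm_inv, norm_norm, inv_mul_cancel₀ (hpos n).ne']
      · simp [inner_smul_left, inner_smul_right, heX m n hmn]
    obtain ⟨B, hB, -, -⟩ := exists_isometry b he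
    obtain ⟨A, -, hA, -⟩ := exists_isometry b hf
    have hdiag : DiagOn b (ContinuousLinearMap.adjoint A * X * B) fun n => ‖X (e n)‖ := fun n => by
      have h1 : X (e n) = (‖X (e n)‖ : ℂ) • ((‖X (e n)‖⁻¹ : ℝ) : ℂ) • X (e n) := by
        rw [smul_smul, ← Complex.ofReal_mul, mul_inv_cancel₀ (hpos n).ne', Complex.ofReal_one,
          one_smul]
      simp only [mul_apply_eq_comp]
      rw [hB]
      conv_lhs => rw [h1]
      rw [map_smul, hA]
    have hmem : ContinuousLinearMap.adjoint A * X * B ∈ J :=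
      J.mul_mem_right _ _ (J.mul_mem_left _ _ hXJ)
    -- Only even-indexed `s`-numbers are controlled; doubling this sequence dominates all of them by
    -- monotonicity.
    have hev : (fun n => sNumbers X (2 * n)) ∈ c0Star := c0Star.comp hX
      (fun _ _ h => Nat.mul_le_mul_left 2 h) (tendsto_id.const_mul_atTop' two_pos)
    obtain ⟨Z, hZ⟩ := exists_diagOn_of_mem b hev
    have hZJ : Z ∈ J := hdiag.mem_of_le hZ hmem zero_le_two (fun n => (hpos n).le) fun n => by
      rw [abs_of_nonneg (hs _).le]
      linarith [hle n]
    obtain ⟨W, hW⟩ := exists_diagOn_of_mem b (c0Star.double hev)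
    have hWJ : W ∈ J := hZ.double_mem hZJ hW
    refine hW.mem_of_le hD hWJ zero_le_one (fun n => (hs _).le) fun n => ?_
    rw [abs_of_nonneg (hs _).le, one_mul]
    exact hX.1 (by omega)
  · push Not at hs
    obtain ⟨N, hN⟩ := hs
    by_cases hX0 : X = 0
    · have : D = 0 := ext_on_basis b fun n => by
        rw [hD, hX0, sNumbers_zero]
        simp
      rw [this]
      exact J.zero_mem
    · exact hD.mem_of_finite hXJ hX0 (N := N) fun n hn =>
        le_antisymm ((hX.1 hn).trans hN) (sNumbers_nonneg _ _)

/-- This reduces the closure properties to diagonal operators in one fixed basis. -/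
theorem mem_charSet_iff [CompleteSpace H] (b : HilbertBasis ℕ ℂ H)
    {J : TwoSidedIdeal (H →L[ℂ] H)} {x : ℕ → ℝ} :
    x ∈ charSet J ↔ x ∈ c0Star ∧ ∃ D ∈ J, DiagOn b D x := by
  constructor
  · rintro ⟨hx, X, hX, rfl⟩
    obtain ⟨D, hD⟩ := exists_diagOn_of_mem b hx
    exact ⟨hx, D, hD.mem_of_sNumbers hX hx, hD⟩
  · rintro ⟨hx, D, hD, h⟩
    exact mem_charSet_of_diagOn h hx hD

theorem isCharSet_charSet [CompleteSpace H] (b : HilbertBasis ℕ ℂ H)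
    {J : TwoSidedIdeal (H →L[ℂ] H)} (hJ : J ≠ ⊥) : IsCharSet (charSet J) where
  subset _ h := h.1
  solid := by
    intro x y hx hy h
    obtain ⟨hy0, D, hD, hDy⟩ := (mem_charSet_iff b).1 hy
    obtain ⟨E, hE⟩ := exists_diagOn_of_mem b hx
    refine mem_charSet_of_diagOn hE hx (hDy.mem_of_le hE hD zero_le_one (c0Star.nonneg hy0)
      fun n => ?_)
    rw [abs_of_nonneg (c0Star.nonneg hx n), one_mul]
    exact h n
  add := by
    intro x y hx hy
    obtain ⟨hx0, D, hD, hDx⟩ := (mem_charSet_iff b).1 hx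
    obtain ⟨hy0, E, hE, hEy⟩ := (mem_charSet_iff b).1 hy
    exact mem_charSet_of_diagOn (hDx.add hEy) (c0Star.add hx0 hy0) (J.add_mem hD hE)
  double := by
    intro x hx
    obtain ⟨hx0, D, hD, hDx⟩ := (mem_charSet_iff b).1 hx
    obtain ⟨E, hE⟩ := exists_diagOn_of_mem b (c0Star.double hx0)
    exact mem_charSet_of_diagOn hE (c0Star.double hx0) (hDx.double_mem hD hE)
  finite := by
    intro x N hx h
    obtain ⟨X, hX, hX0⟩ : ∃ X ∈ J, X ≠ 0 := by
      by_contra! h0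
      refine hJ (TwoSidedIdeal.ext fun X => ⟨fun hX => ?_, fun hX => ?_⟩)
      · rw [h0 X hX]
        exact TwoSidedIdeal.zero_mem _
      · rw [(TwoSidedIdeal.mem_bot _).1 hX]
        exact J.zero_mem
    obtain ⟨E, hE⟩ := exists_diagOn_of_mem b hx
    exact mem_charSet_of_diagOn hE hx (hE.mem_of_finite hX hX0 h)

/-- Different operators may realize `x` in `J` and in `K`, but the diagonal operator in the basis
`b` is common to both. -/
theorem charSet_inf [CompleteSpace H] (b : HilbertBasis ℕ ℂ H) (J K : TwoSidedIdeal (H →L[ℂ] H)) :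
    charSet (J ⊓ K) = charSet J ∩ charSet K := by
  ext x
  constructor
  · rintro ⟨hx, X, hX, h⟩
    have hX' := (TwoSidedIdeal.mem_inf _).1 hX
    exact ⟨⟨hx, X, hX'.1, h⟩, hx, X, hX'.2, h⟩
  · rintro ⟨hJ, hK⟩
    obtain ⟨hx, D, hD, hDx⟩ := (mem_charSet_iff b).1 hJ
    obtain ⟨-, E, hE, hEx⟩ := (mem_charSet_iff b).1 hK
    obtain rfl := hDx.unique hEx
    exact mem_charSet_of_diagOn hDx hx ((TwoSidedIdeal.mem_inf _).2 ⟨hD, hE⟩)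

theorem charSet_inf_traceClass [CompleteSpace H] (b : HilbertBasis ℕ ℂ H)
    (J : TwoSidedIdeal (H →L[ℂ] H)) : charSet (J ⊓ traceClass) = charSet J ∩ ell1Star := by
  rw [charSet_inf b, traceClass, charSet_idealOf b ell1Star.isCharSet]

/-- A separable infinite-dimensional Hilbert space has a basis indexed by `ℕ`. -/
theorem exists_hilbertBasis_nat [CompleteSpace H] [TopologicalSpace.SeparableSpace H]
    (hH : ¬ FiniteDimensional ℂ H) : Nonempty (HilbertBasis ℕ ℂ H) := by
  obtain ⟨w, b, hb⟩ := exists_hilbertBasis ℂ H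
  have hdense := b.dense_span
  have hinf : Infinite w := by
    by_contra hfin
    rw [not_infinite_iff_finite] at hfin
    have : FiniteDimensional ℂ (Submodule.span ℂ (Set.range b)) :=
      FiniteDimensional.span_of_finite ℂ (Set.finite_range b)
    rw [(Submodule.closed_of_finiteDimensional _).submodule_topologicalClosure_eq] at hdense
    rw [hdense] at this
    exact hH (Module.Finite.equiv Submodule.topEquiv)
  have hcount : Countable w := by
    -- Balls of radius `1 / 2` around the basis vectors are then disjoint, and separability allows
    -- only countably many.
    have hdist : ∀ i j : w, i ≠ j → 1 ≤ dist (b i) (b j) := fun i j hij => by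
      have h := norm_sub_sq (𝕜 := ℂ) (b i) (b j)
      rw [b.orthonormal.2 hij, b.orthonormal.1, b.orthonormal.1] at h
      rw [dist_eq_norm]
      simp only [map_zero] at h
      nlinarith [norm_nonneg (b i - b j)]
    refine Set.countable_univ_iff.1 (Set.PairwiseDisjoint.countable_of_isOpen
      (s := fun i : w => Metric.ball (b i) (1 / 2)) (fun i _ j _ hij => ?_)
      (fun i _ => Metric.isOpen_ball) fun i _ => ⟨b i, Metric.mem_ball_self (by norm_num)⟩)
    exact Metric.ball_disjoint_ball (by linarith [hdist i j hij])
  obtain ⟨f⟩ := nonempty_equiv_of_countable (α := ℕ) (β := w)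
  refine ⟨HilbertBasis.mk (b.orthonormal.comp f f.injective) ?_⟩
  rw [f.surjective.range_comp]
  exact hdense.ge

end OperatorIdeal

open OperatorIdeal in
theorem theorem6p9 {H : Type*} [NormedAddCommGroup H] [InnerProductSpace ℂ H] [CompleteSpace H]
    [TopologicalSpace.SeparableSpace H] (hH : ¬ FiniteDimensional ℂ H)
    (I : TwoSidedIdeal (H →L[ℂ] H)) (hI : I ≠ ⊥) :
    OperatorIdeal.sc (OperatorIdeal.preAmInf I) = OperatorIdeal.preAmInf (OperatorIdeal.sc I) ∧
    OperatorIdeal.se (OperatorIdeal.amInf I) = OperatorIdeal.amInf (OperatorIdeal.se I) ∧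
    OperatorIdeal.amInf (OperatorIdeal.sc I) ≤ OperatorIdeal.sc (OperatorIdeal.amInf I) ∧
    OperatorIdeal.se (OperatorIdeal.preAmInf I) = OperatorIdeal.preAmInf (OperatorIdeal.se I) := by
  obtain ⟨b⟩ := exists_hilbertBasis_nat hH
  have hS := isCharSet_charSet b hI
  have hse : charSet (se I) = softInterior (charSet I) := charSet_idealOf b hS.softInterior
  have hsc : charSet (sc I) = softCover (charSet I) := charSet_idealOf b hS.softCover
  have hpre : charSet (preAmInf I) = preMeanInf (charSet I) := charSet_idealOf b hS.preMeanInf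
  have ham : charSet (amInf I) = meanInf (charSet I ∩ ell1Star) := by
    rw [← charSet_inf_traceClass b]
    refine charSet_idealOf b ?_
    rw [charSet_inf_traceClass b]
    exact (hS.inter ell1Star.isCharSet).meanInf Set.inter_subset_right
  refine ⟨?_, ?_, ?_, ?_⟩
  · change idealOf (softCover (charSet (preAmInf I))) = idealOf (preMeanInf (charSet (sc I)))
    rw [hpre, hsc, softCover_preMeanInf hS]
  · change idealOf (softInterior (charSet (amInf I))) =
      idealOf (meanInf (charSet (se I ⊓ traceClass)))
    rw [ham, charSet_inf_traceClass b, hse, softInterior_meanInf hS]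
  · change idealOf (meanInf (charSet (sc I ⊓ traceClass))) ≤
      idealOf (softCover (charSet (amInf I)))
    rw [ham, charSet_inf_traceClass b, hsc]
    refine TwoSidedIdeal.span_mono ?_
    rintro X ⟨x, hx, hX⟩
    exact ⟨x, meanInf_softCover_subset hx, hX⟩
  · change idealOf (softInterior (charSet (preAmInf I))) = idealOf (preMeanInf (charSet (se I)))
    rw [hpre, hse, softInterior_preMeanInf hS]
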